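/- The following problem is decidable. Let $F_2$ be the free group with basis $\{a,b\}$. Given a word $u$ over the alphabet $\{a,b,a^{-1},b^{-1}\}$, representing an element of $F_2$, and a finite list of words $h_1,\ldots,h_r$ ($r \ge 0$) over the same alphabet, representing generators of the finitely generated subgroup $H=\langle h_1,\ldots,h_r\rangle \le F_2$, decide whether or not there is an automorphism $\varphi$ of $F_2$ such that $\varphi(u)\in H$. That is, there is a single algorithm (computable function) which, on every input $(u,(h_1,\ldots,h_r))$, halts with the correct answer. -/

import Mathlib

/-- The free group of rank two, with basis `a = FreeGroup.of 0`, `b = FreeGroup.of 1`. -/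
abbrev F2 : Type := FreeGroup (Fin 2)

/-- Words over the letters `a, b, a⁻¹, b⁻¹` (not necessarily reduced): the pair `(i, true)` is the
`i`-th basis letter and `(i, false)` is its formal inverse. -/
abbrev Word2 : Type := List (Fin 2 × Bool)

/-- The element of the free group that a word represents. -/
def Word2.toF2 (w : Word2) : F2 := FreeGroup.mk w

/-- The finitely generated subgroup of the free group given by a finite list of words:
the subgroup generated by the elements that these words represent. -/
def subgroupOfWords (L : List Word2) : Subgroup F2 :=
  Subgroup.closure {g : F2 | ∃ w ∈ L, Word2.toF2 w = g}

/-- Every finitely generated subgroup is given by some finite list of words. -/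
theorem exists_subgroupOfWords_eq (H : Subgroup F2) (hH : H.FG) :
    ∃ L : List Word2, subgroupOfWords L = H := by
  obtain ⟨S, rfl⟩ := hH
  refine ⟨S.toList.map FreeGroup.toWord, ?_⟩
  unfold subgroupOfWords Word2.toF2
  congr 1
  ext g
  simp [FreeGroup.mk_toWord]

/-- The subgroup `H` meets the orbit of `u` under the automorphism group of the free group. -/
def MeetsAutOrbit (u : F2) (H : Subgroup F2) : Prop :=
  ∃ φ : MulAut F2, φ u ∈ H

/-!
Two searches run in parallel. If some automorphism moves `u` into `H`, an enumeration of all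
candidates finds it. If there is none, this has to be recognised from finitely many facts, and the
proof consists in showing that this is possible.

*Reduction to positive automorphisms.* By a version of Nielsen's reduction (`inNormalForm`), every
automorphism of the free group of rank two is, up to an inner automorphism, of the form `d₁ ψ d₂`
where `d₁`, `d₂` permute the letters and their inverses and `ψ` is a product of the twists
`twist c`, which fix the letter `c` and replace the other letter `d` by `c d`. As there are only
finitely many `d₁`, `d₂`, it suffices to decide whether some `ψ u` is conjugate to an element of a
finitely generated subgroup `H`, and on replacing `H` by its image under `twist 0 * twist 1` the
automorphism `ψ` may be taken to be one of the `codeAut r`, which end with these two twists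
(`meetsAutOrbit_iff`).

*Obstructions.* An element is conjugate into `H` if and only if it labels a closed walk, up to
conjugacy, in the Schreier graph of `H`. The generators of `H` trace out a finite folded subgraph.
If no `codeAut r u` is conjugate into `H`, then no `codeAut r u` labels a closed walk there
(`exists_isObstruction`); conversely, a finite folded graph in which the generators label closed
walks at one vertex, and in which no `codeAut r u` labels a closed walk, proves that the answer is
negative (`IsObstruction.not_codeAutMeets`). So such graphs can be searched for, provided that it
can be checked for a given finite graph that no `codeAut r u` labels a closed walk in it.

*Finitely many `r` suffice.* Write `ψ = codeAut r`. The images of the letters under `ψ` are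
positive words, and `ψ (a b)` and `ψ (b a)` have a common prefix `P` followed by `a b` and `b a`,
respectively. Hence for a positive word `B` in which both letters occur, `ψ B` is `P` times a
positive word which starts with the first letter of `B` and ends with its last letter. In a cyclic
product `B₁ B₂⁻¹ B₃ B₄⁻¹ ⋯` of such blocks whose facing letters differ, the factors `P` cancel and
what remains is the cyclically reduced form of its image under `ψ`. It is a product of a fixed
pattern of six positive words that depend on `ψ` alone (`WordData`), so whether it labels a closed
walk depends only on the six relations on the vertices given by walks reading these words. These
relations take finitely many values, and they change deterministically if `ψ` is composed with a
twist (`graphState_cons_congr`). Therefore, if any `r` yields a closed walk, then one of bounded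
length does (`IsTame.hasLoop_congr`, `TameWithin.exists_short`).

An arbitrary `u` is a cyclic product of positive words and their inverses some of which may be
powers of a single letter. A twist by `c` turns powers of the other letter into words with both
letters and, up to a common conjugation, shortens powers of `c`, possibly until neighbouring words
can be merged. This continues until the words with one letter are all equal to one and the same
letter `e`, and such letters are absorbed by the neighbouring blocks at the cost of admitting the
conjugates `e⁻¹ d e` in them. The number of twists needed is bounded by a computable function of
the length of `u` (`tameWithin_mk`).
-/

/-! ### Walks in folded labelled graphs -/

section Walks

variable {V α : Type*}

/-- One step along an edge of the labelled graph `E`: the letter `(i, true)` follows an `i`-edge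
forwards and `(i, false)` follows one backwards. -/
def EdgeStep (E : V → α → V → Prop) (v : V) (x : α × Bool) (w : V) : Prop :=
  if x.2 then E v x.1 w else E w x.1 v

/-- `Walk E v p w`: the word `p` can be read along a walk from `v` to `w` in the graph `E`. -/
def Walk (E : V → α → V → Prop) : V → List (α × Bool) → V → Prop
  | v, [], w => v = w
  | v, x :: p, w => ∃ z, EdgeStep E v x z ∧ Walk E z p w

/-- A labelled graph is folded if no two different edges with the same label share their source or
share their target. -/
def Folded (E : V → α → V → Prop) : Prop :=
  (∀ v i w w', E v i w → E v i w' → w = w') ∧ ∀ v v' i w, E v i w → E v' i w → v = v'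

variable {E : V → α → V → Prop}

theorem walk_append {v w : V} {p q : List (α × Bool)} :
    Walk E v (p ++ q) w ↔ ∃ z, Walk E v p z ∧ Walk E z q w := by
  induction p generalizing v with
  | nil => simp [Walk]
  | cons x p ih =>
    simp only [List.cons_append, Walk, ih]
    exact ⟨fun ⟨y, h, z, h1, h2⟩ => ⟨z, ⟨y, h, h1⟩, h2⟩,
      fun ⟨z, ⟨y, h, h1⟩, h2⟩ => ⟨y, h, z, h1, h2⟩⟩

theorem walk_singleton {v w : V} {x : α × Bool} : Walk E v [x] w ↔ EdgeStep E v x w := by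
  simp [Walk]

theorem edgeStep_inv {v w : V} {x : α × Bool} :
    EdgeStep E v (x.1, !x.2) w ↔ EdgeStep E w x v := by
  rcases x with ⟨i, b⟩; cases b <;> simp [EdgeStep]

theorem walk_invRev {v w : V} {p : List (α × Bool)} :
    Walk E v (FreeGroup.invRev p) w ↔ Walk E w p v := by
  induction p generalizing v w with
  | nil => simp [Walk, eq_comm]
  | cons x p ih =>
    rw [show FreeGroup.invRev (x :: p) = FreeGroup.invRev p ++ [(x.1, !x.2)] by
      simp [FreeGroup.invRev], walk_append]
    simp only [ih, Walk.eq_2, Walk.eq_1, exists_eq_right, edgeStep_inv]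
    exact exists_congr fun z => and_comm

theorem EdgeStep.unique (hE : Folded E) {v w w' : V} {x : α × Bool} (h : EdgeStep E v x w)
    (h' : EdgeStep E v x w') : w = w' := by
  rcases x with ⟨i, b⟩
  cases b
  · exact hE.2 _ _ i v (by simpa [EdgeStep] using h) (by simpa [EdgeStep] using h')
  · exact hE.1 v i _ _ (by simpa [EdgeStep] using h) (by simpa [EdgeStep] using h')

theorem Walk.unique (hE : Folded E) {p : List (α × Bool)} {v w w' : V} (h : Walk E v p w)
    (h' : Walk E v p w') : w = w' := by
  induction p generalizing v with
  | nil => exact h.symm.trans h'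
  | cons x p ih =>
    obtain ⟨z, h1, h2⟩ := h
    obtain ⟨z', h1', h2'⟩ := h'
    obtain rfl := h1.unique hE h1'
    exact ih h2 h2'

theorem Walk.unique_left (hE : Folded E) {p : List (α × Bool)} {v v' w : V} (h : Walk E v p w)
    (h' : Walk E v' p w) : v = v' :=
  Walk.unique hE (walk_invRev.2 h) (walk_invRev.2 h')

theorem Walk.red (hE : Folded E) {p q : List (α × Bool)} (hpq : FreeGroup.Red p q) {v w : V}
    (h : Walk E v p w) : Walk E v q w := by
  induction hpq with
  | refl => exact h
  | tail _ hs ih =>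
    rcases hs with @⟨L₁, L₂, x, b⟩
    obtain ⟨z, h1, z1, h2, z2, h3, h4⟩ := walk_append.1 ih
    have h3' : EdgeStep E z2 (x, b) z1 := edgeStep_inv.1 (by simpa using h3)
    obtain rfl : z = z2 := Walk.unique_left hE (walk_singleton.2 h2) (walk_singleton.2 h3')
    exact walk_append.2 ⟨z, h1, h4⟩

theorem Walk.reduce [DecidableEq α] (hE : Folded E) {p : List (α × Bool)} {v w : V}
    (h : Walk E v p w) : Walk E v (FreeGroup.reduce p) w :=
  h.red hE FreeGroup.reduce.red

/-- The group element `g` is conjugate to the label of a closed walk in the graph `E`. -/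
def HasLoop (E : V → α → V → Prop) (g : FreeGroup α) : Prop :=
  ∃ v p, IsConj (FreeGroup.mk p) g ∧ Walk E v p v

theorem HasLoop.conj {g h : FreeGroup α} (hg : HasLoop E g) (hc : IsConj g h) : HasLoop E h := by
  obtain ⟨v, p, hp, hw⟩ := hg
  exact ⟨v, p, hp.trans hc, hw⟩

theorem HasLoop.inv {g : FreeGroup α} (hg : HasLoop E g) : HasLoop E g⁻¹ := by
  obtain ⟨v, p, hp, hw⟩ := hg
  refine ⟨v, FreeGroup.invRev p, ?_, walk_invRev.2 hw⟩
  rw [← FreeGroup.inv_mk]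
  obtain ⟨c, hc⟩ := isConj_iff.1 hp
  exact isConj_iff.2 ⟨c, by rw [← hc]; group⟩

theorem isCyclicallyReduced_concat {x : α × Bool} {k : List (α × Bool)} :
    FreeGroup.IsCyclicallyReduced (k ++ [x]) ↔ FreeGroup.IsCyclicallyReduced (x :: k) := by
  rcases k with _ | ⟨y, k⟩
  · simp
  rw [FreeGroup.isCyclicallyReduced_cons_append_iff, FreeGroup.IsReduced, List.isChain_append,
    FreeGroup.isCyclicallyReduced_iff, FreeGroup.isReduced_cons_cons, FreeGroup.IsReduced]
  simp only [List.isChain_singleton, List.head?_cons, Option.mem_def, Option.some.injEq, true_and,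
    forall_eq', List.getLast?_cons_cons]
  tauto

/-- A cyclically reduced word labels a closed walk of a folded graph as soon as some conjugate of
it does. The conjugator is shortened letter by letter, rotating the word whenever it cancels
against the conjugator. -/
theorem exists_walk_of_hasLoop_mk [DecidableEq α] (hE : Folded E) {k : List (α × Bool)}
    (hk : FreeGroup.IsCyclicallyReduced k) (h : HasLoop E (FreeGroup.mk k)) :
    ∃ v, Walk E v k v := by
  obtain ⟨v, p, hp, hw⟩ := h
  obtain ⟨g, hg⟩ := isConj_iff.1 hp.symm
  have key : ∀ (n : ℕ) (c k : List (α × Bool)), c.length = n → FreeGroup.IsReduced c →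
      FreeGroup.IsCyclicallyReduced k →
      FreeGroup.mk c * FreeGroup.mk k * (FreeGroup.mk c)⁻¹ = FreeGroup.mk p →
      ∃ v, Walk E v k v := by
    intro n
    induction n with
    | zero =>
      intro c k hc _ hk he
      rw [List.length_eq_zero_iff] at hc
      subst hc
      refine ⟨v, ?_⟩
      have he' : FreeGroup.mk k = FreeGroup.mk p := by
        simpa [← FreeGroup.one_eq_mk] using he
      rw [← hk.isReduced.reduce_eq, FreeGroup.reduce.sound he']
      exact hw.reduce hE
    | succ n ih =>
      intro c k hc hcr hk he
      obtain ⟨c, x, rfl⟩ : ∃ c' x, c = c' ++ [x] := by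
        rcases List.eq_nil_or_concat c with h | ⟨c', x, h⟩
        · simp [h] at hc
        · exact ⟨c', x, by simpa using h⟩
      have hlen : c.length = n := by simpa using hc
      have hcr' : FreeGroup.IsReduced c := hcr.infix ⟨[], [x], by simp⟩
      by_cases hk0 : k = []
      · subst hk0; exact ⟨v, rfl⟩
      by_cases h1 : ∃ k', k = (x.1, !x.2) :: k'
      · obtain ⟨k', rfl⟩ := h1
        obtain ⟨w, hw'⟩ := ih c (k' ++ [(x.1, !x.2)]) hlen hcr'
          (isCyclicallyReduced_concat.2 hk) (by
          rw [← he]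
          simp only [← FreeGroup.mul_mk, ← List.singleton_append (x := (x.1, !x.2)) (l := k')]
          have : FreeGroup.mk [(x.1, !x.2)] = (FreeGroup.mk [x])⁻¹ := by
            simp [FreeGroup.inv_mk, FreeGroup.invRev]
          rw [this]; group)
        obtain ⟨z, hz1, hz2⟩ := walk_append.1 hw'
        exact ⟨z, walk_append (p := [(x.1, !x.2)]).2 ⟨w, hz2, hz1⟩⟩
      by_cases h2 : ∃ k', k = k' ++ [x]
      · obtain ⟨k', rfl⟩ := h2
        obtain ⟨w, hw'⟩ := ih c (x :: k') hlen hcr' (isCyclicallyReduced_concat.1 hk) (by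
          rw [← he]
          simp only [← FreeGroup.mul_mk, ← List.singleton_append (x := x) (l := k')]
          group)
        obtain ⟨z, hz1, hz2⟩ := walk_append (p := [x]).1 hw'
        exact ⟨z, walk_append.2 ⟨w, hz2, hz1⟩⟩
      -- neither end cancels: the conjugated word is reduced as it stands
      have hred : FreeGroup.IsReduced ((c ++ [x]) ++ k ++ FreeGroup.invRev (c ++ [x])) := by
        have hinv : FreeGroup.IsReduced (FreeGroup.invRev (c ++ [x])) := by
          rw [FreeGroup.isReduced_iff_reduce_eq, FreeGroup.reduce_invRev, hcr.reduce_eq]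
        refine FreeGroup.IsReduced.append_overlap ?_ ?_ hk0
        · rw [FreeGroup.IsReduced, List.isChain_append]
          refine ⟨hcr, hk.isReduced, ?_⟩
          intro a ha b hb hab
          simp only [List.getLast?_append, List.getLast?_singleton, Option.mem_def,
            Option.some.injEq, Option.or] at ha
          subst ha
          rcases k with _ | ⟨y, k⟩
          · simp at hb
          · simp only [List.head?_cons, Option.mem_def, Option.some.injEq] at hb
            subst hb
            by_contra hne
            refine h1 ⟨k, ?_⟩
            rw [show y = (x.1, !x.2) from Prod.ext hab.symm (Bool.eq_not.2 (Ne.symm hne))]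
        · rw [FreeGroup.IsReduced, List.isChain_append]
          refine ⟨hk.isReduced, hinv, ?_⟩
          intro a ha b hb hab
          have hb' : b = (x.1, !x.2) := by
            simpa [FreeGroup.invRev, eq_comm] using hb
          subst hb'
          rcases List.eq_nil_or_concat k with h | ⟨k', y, h⟩
          · exact absurd h hk0
          · subst h
            have ha' : y = a := by simpa using ha
            subst ha'
            by_contra hne
            refine h2 ⟨k', ?_⟩
            rw [List.concat_eq_append, show y = x from Prod.ext hab (by simpa using hne)]
      have hw2 : Walk E v ((c ++ [x]) ++ k ++ FreeGroup.invRev (c ++ [x])) v := by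
        have he' : FreeGroup.mk ((c ++ [x]) ++ k ++ FreeGroup.invRev (c ++ [x])) =
            FreeGroup.mk p := by
          rw [← he, ← FreeGroup.mul_mk, ← FreeGroup.mul_mk, FreeGroup.inv_mk]
        rw [← hred.reduce_eq, FreeGroup.reduce.sound he']
        exact hw.reduce hE
      obtain ⟨z, hz, hz3⟩ := walk_append.1 hw2
      obtain ⟨y, hy1, hy2⟩ := walk_append.1 hz
      obtain rfl := hy1.unique hE (walk_invRev.1 hz3)
      exact ⟨y, hy2⟩
  refine key _ g.toWord k rfl FreeGroup.isReduced_toWord hk ?_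
  rw [FreeGroup.mk_toWord, hg]

/-- The elements of the free group whose reduced words label closed walks at a vertex of a folded
graph form a subgroup. -/
theorem walk_toWord_of_mem_closure [DecidableEq α] (hE : Folded E) {v : V} {S : Set (FreeGroup α)}
    (hS : ∀ g ∈ S, Walk E v g.toWord v) {g : FreeGroup α} (hg : g ∈ Subgroup.closure S) :
    Walk E v g.toWord v := by
  induction hg using Subgroup.closure_induction with
  | mem x hx => exact hS x hx
  | one => simp [Walk]
  | mul x y _ _ hx hy =>
    rw [FreeGroup.toWord_mul]
    exact (walk_append.2 ⟨v, hx, hy⟩).reduce hE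
  | inv x _ hx =>
    rw [FreeGroup.toWord_inv]
    exact walk_invRev.2 hx

end Walks

/-! ### Positive words and the twist automorphisms -/

/-- The other letter of the two-letter alphabet. -/
def other (c : Fin 2) : Fin 2 := Fin.rev c

@[simp] theorem other_other (c : Fin 2) : other (other c) = c := Fin.rev_rev c

theorem other_ne (c : Fin 2) : other c ≠ c := by revert c; decide

theorem eq_other_of_ne {c d : Fin 2} (h : c ≠ d) : c = other d := by revert c d; decide

/-- The word over the letters and their inverses given by a positive word. -/
def posWord (p : List (Fin 2)) : Word2 := p.map fun i => (i, true)

/-- The element of the free group represented by a positive word. -/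
def posVal (p : List (Fin 2)) : F2 := FreeGroup.mk (posWord p)

@[simp] theorem posWord_append (p q : List (Fin 2)) :
    posWord (p ++ q) = posWord p ++ posWord q := by simp [posWord]

@[simp] theorem posVal_nil : posVal [] = 1 := rfl

@[simp] theorem posVal_append (p q : List (Fin 2)) : posVal (p ++ q) = posVal p * posVal q := by
  simp [posVal]

theorem posVal_cons (c : Fin 2) (p : List (Fin 2)) :
    posVal (c :: p) = FreeGroup.of c * posVal p := by
  simp [posVal, posWord, FreeGroup.of]

theorem posVal_replicate_flatten (n : ℕ) (p : List (Fin 2)) :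
    posVal (List.replicate n p).flatten = posVal p ^ n := by
  induction n with
  | zero => simp
  | succ n ih => simp [List.replicate_succ, ih, pow_succ']

theorem isReduced_posWord (p : List (Fin 2)) : FreeGroup.IsReduced (posWord p) := by
  rw [FreeGroup.IsReduced, posWord, List.isChain_map]
  exact List.Pairwise.isChain (List.pairwise_of_forall fun _ _ _ => rfl)

theorem isCyclicallyReduced_posWord (p : List (Fin 2)) :
    FreeGroup.IsCyclicallyReduced (posWord p) := by
  refine ⟨isReduced_posWord p, ?_⟩
  intro a ha b hb _
  have h1 := List.mem_of_getLast? ha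
  have h2 := List.mem_of_head? hb
  simp only [posWord, List.mem_map] at h1 h2
  obtain ⟨_, _, rfl⟩ := h1
  obtain ⟨_, _, rfl⟩ := h2
  rfl

/-- The automorphism fixing the letter `c` and sending the other letter `d` to `c * d`. -/
def twist (c : Fin 2) : MulAut F2 :=
  MonoidHom.toMulEquiv
    (FreeGroup.lift fun i => if i = c then FreeGroup.of c else FreeGroup.of c * FreeGroup.of i)
    (FreeGroup.lift fun i => if i = c then FreeGroup.of c else (FreeGroup.of c)⁻¹ * FreeGroup.of i)
    (by ext i; by_cases h : i = c <;> simp [h])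
    (by ext i; by_cases h : i = c <;> simp [h])

@[simp] theorem twist_of (c : Fin 2) : twist c (FreeGroup.of c) = FreeGroup.of c := by
  simp [twist]

@[simp] theorem twist_of_other (c : Fin 2) :
    twist c (FreeGroup.of (other c)) = FreeGroup.of c * FreeGroup.of (other c) := by
  simp [twist, other_ne]

/-- A list of letters encodes a product of twists. The head of the list is the twist that acts
first on an element of the free group, and every such product starts, on the other side, with
`twist 0 * twist 1`; hence both letters have images of length at least two. -/
def codeAut : List (Fin 2) → MulAut F2
  | [] => twist 0 * twist 1
  | c :: r => codeAut r * twist c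

/-- The positive words describing a product `φ` of twists: the images of the letters, the images
of the letters under the conjugate of `φ` that is positive with images starting in different
letters, and the images of the elements `c⁻¹ d c` for the two letters `c ≠ d`. -/
structure WordData where
  /-- The image of each letter. -/
  img : Fin 2 → List (Fin 2)
  /-- The image of each letter under the conjugated automorphism. -/
  cimg : Fin 2 → List (Fin 2)
  /-- The image of the conjugate by `c` of the other letter. -/
  zimg : Fin 2 → List (Fin 2)

/-- The word data of the product of twists encoded by a list. -/
def wordData : List (Fin 2) → WordData
  | [] => ⟨![[0, 1, 0], [0, 1]], ![[0, 1, 0], [1, 0]], ![[1, 0], [0, 0, 1]]⟩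
  | c :: r =>
    ⟨fun i => if i = c then (wordData r).img c else (wordData r).img c ++ (wordData r).img i,
     fun i => if i = c then (wordData r).cimg c else (wordData r).cimg i ++ (wordData r).cimg c,
     fun i => if i = c then (wordData r).img (other c) ++ (wordData r).img c
       else (wordData r).zimg i⟩

/-- The conjugate by the letter `c` of the other letter. -/
def conjLetter (c : Fin 2) : F2 :=
  (FreeGroup.of c)⁻¹ * FreeGroup.of (other c) * FreeGroup.of c

/-- `D` consists of the words that describe the automorphism `φ`, where `P` conjugates between
the two positive forms of `φ`; the equation for `φ (c d)` says that the longest common prefix of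
`φ (c d)` and `φ (d c)` is `P`. -/
structure Describes (D : WordData) (φ : MulAut F2) (P : F2) : Prop where
  img : ∀ c, posVal (D.img c) = φ (FreeGroup.of c)
  cimg : ∀ c, posVal (D.cimg c) = P⁻¹ * φ (FreeGroup.of c) * P
  zimg : ∀ c, posVal (D.zimg c) = φ (conjLetter c)
  pref : ∀ c, φ (FreeGroup.of c * FreeGroup.of (other c)) =
    P * (FreeGroup.of c * FreeGroup.of (other c))
  img_last : ∀ c, (D.img c).getLast? = some c
  cimg_head : ∀ c, (D.cimg c).head? = some c
  zimg_last : ∀ c, (D.zimg c).getLast? = some c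

theorem getLast?_append_of_eq_some {α : Type*} {p q : List α} {c : α} (h : q.getLast? = some c) :
    (p ++ q).getLast? = some c := by simp [h]

theorem twist_conjLetter (c : Fin 2) :
    twist c (conjLetter c) = FreeGroup.of (other c) * FreeGroup.of c := by
  simp only [conjLetter, map_mul, map_inv, twist_of, twist_of_other]; group

theorem twist_conjLetter_other (c : Fin 2) :
    twist c (conjLetter (other c)) = conjLetter (other c) := by
  simp only [conjLetter, map_mul, map_inv, twist_of, twist_of_other, other_other]; group

/-- Composition with a further twist changes the describing words in a way that depends on these
words only. -/
theorem Describes.step {D : WordData} {φ : MulAut F2} {P : F2} (h : Describes D φ P) (c : Fin 2) :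
    Describes ⟨fun i => if i = c then D.img c else D.img c ++ D.img i,
     fun i => if i = c then D.cimg c else D.cimg i ++ D.cimg c,
     fun i => if i = c then D.img (other c) ++ D.img c else D.zimg i⟩ (φ * twist c)
     (φ (FreeGroup.of c) * P) := by
  have hcase : ∀ i : Fin 2, i = c ∨ i = other c := fun i => by
    by_cases h : i = c
    · exact Or.inl h
    · exact Or.inr (eq_other_of_ne h)
  constructor
  · intro i
    rcases hcase i with rfl | rfl
    · simp [h.img]
    · simp [h.img, other_ne]
  · intro i
    rcases hcase i with rfl | rfl
    · simp only [if_true, h.cimg, MulAut.mul_apply, twist_of]; group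
    · simp only [if_neg (other_ne c), posVal_append, h.cimg, MulAut.mul_apply, twist_of_other,
        map_mul]; group
  · intro i
    rcases hcase i with rfl | rfl
    · simp [h.img, twist_conjLetter]
    · simp [h.zimg, other_ne, twist_conjLetter_other]
  · intro i
    have h1 := h.pref c
    have h2 := h.pref (other c)
    rw [other_other] at h2
    rw [map_mul] at h1 h2
    rcases hcase i with rfl | rfl
    · simp only [MulAut.mul_apply, map_mul, twist_of, twist_of_other]
      rw [h1]; group
    · simp only [MulAut.mul_apply, map_mul, twist_of, twist_of_other, other_other]
      rw [mul_assoc, h2]; group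
  · intro i
    rcases hcase i with rfl | rfl
    · simp [h.img_last]
    · simp [h.img_last, other_ne]
  · intro i
    rcases hcase i with rfl | rfl
    · simp [h.cimg_head]
    · simp [h.cimg_head, other_ne]
  · intro i
    rcases hcase i with rfl | rfl
    · simp [h.img_last]
    · simp [h.zimg_last, other_ne]

theorem exists_describes_wordData (r : List (Fin 2)) :
    ∃ P, Describes (wordData r) (codeAut r) P := by
  induction r with
  | nil =>
    have o0 : other 0 = 1 := rfl
    have o1 : other 1 = 0 := rfl
    have t01 : twist 0 (FreeGroup.of 1) = FreeGroup.of 0 * FreeGroup.of 1 := twist_of_other 0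
    have t10 : twist 1 (FreeGroup.of 0) = FreeGroup.of 1 * FreeGroup.of 0 := twist_of_other 1
    refine ⟨posVal [0, 1, 0], ?_⟩
    constructor <;> intro c <;> fin_cases c
    all_goals
      simp [wordData, codeAut, posVal_cons, conjLetter, o0, o1, t01, t10, mul_assoc]
  | cons c r ih =>
    obtain ⟨P, hP⟩ := ih
    exact ⟨_, hP.step c⟩

/-! ### Alternating products of positive blocks -/

/-- The product of `f x * (f y)⁻¹` over the pairs `(x, y)` of a list. -/
def pairVal {β : Type*} (f : β → F2) (l : List (β × β)) : F2 :=
  (l.map fun p => f p.1 * (f p.2)⁻¹).prod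

section PairVal

variable {β γ : Type*} {f : β → F2}

@[simp] theorem pairVal_nil : pairVal f [] = 1 := rfl

@[simp] theorem pairVal_cons (p : β × β) (l : List (β × β)) :
    pairVal f (p :: l) = f p.1 * (f p.2)⁻¹ * pairVal f l := by simp [pairVal]

@[simp] theorem pairVal_append (l m : List (β × β)) :
    pairVal f (l ++ m) = pairVal f l * pairVal f m := by simp [pairVal]

theorem pairVal_map {δ : Type*} (g : δ → β) (l : List (δ × δ)) :
    pairVal f (l.map (Prod.map g g)) = pairVal (fun x => f (g x)) l := by
  simp [pairVal, Function.comp_def]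

theorem isConj_mul_comm {G : Type*} [Group G] (g h : G) : IsConj (g * h) (h * g) :=
  isConj_iff.2 ⟨h, by group⟩

theorem isConj_pairVal_rotate {l m : List (β × β)} (h : l ~r m) :
    IsConj (pairVal f l) (pairVal f m) := by
  obtain ⟨n, rfl⟩ := h
  rw [List.rotate_eq_drop_append_take_mod, pairVal_append]
  conv_lhs => rw [← List.take_append_drop (n % l.length) l, pairVal_append]
  exact isConj_mul_comm _ _

/-- A cyclic list of pairs alternates with respect to the first-letter function `st` and the
last-letter function `en` if the members of each pair differ in `en` and, across neighbouring
pairs, the facing members differ in `st`. These are the places where the cyclic word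
`∏ x y⁻¹` of positive words could cancel. -/
def Alternating (st en : β → γ) (l : List (β × β)) : Prop :=
  (∀ p ∈ l, en p.1 ≠ en p.2) ∧ Cycle.Chain (fun p q => st p.2 ≠ st q.1) (l : Cycle (β × β))

theorem Alternating.rotate {st en : β → γ} {l m : List (β × β)} (h : Alternating st en l)
    (hlm : l ~r m) : Alternating st en m := by
  refine ⟨fun p hp => h.1 p (hlm.mem_iff.2 hp), ?_⟩
  rw [← Cycle.coe_eq_coe.2 hlm]
  exact h.2

theorem alternating_map {δ : Type*} {st en : β → γ} (g : δ → β) (l : List (δ × δ)) :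
    Alternating st en (l.map (Prod.map g g)) ↔
      Alternating (fun x => st (g x)) (fun x => en (g x)) l := by
  unfold Alternating
  rw [← Cycle.map_coe, Cycle.chain_map, List.forall_mem_map]
  rfl

/-- The word obtained from a list of pairs by replacing `(x, y)` with `w x (w y)⁻¹`. -/
def pairWord (w : β → List (Fin 2)) (l : List (β × β)) : Word2 :=
  l.flatMap fun p => posWord (w p.1) ++ FreeGroup.invRev (posWord (w p.2))

theorem mk_pairWord (w : β → List (Fin 2)) (l : List (β × β)) :
    FreeGroup.mk (pairWord w l) = pairVal (fun b => posVal (w b)) l := by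
  induction l with
  | nil => rfl
  | cons p l ih =>
    rw [pairVal_cons, ← ih, pairWord, List.flatMap_cons, ← FreeGroup.mul_mk, ← FreeGroup.mul_mk,
      ← FreeGroup.inv_mk]
    rfl

variable {st en : β → Fin 2} {w : β → List (Fin 2)}

theorem head?_pairWord_cons (hst : ∀ b, (w b).head? = some (st b)) (p : β × β)
    (l : List (β × β)) : (pairWord w (p :: l)).head? = some (st p.1, true) := by
  simp [pairWord, posWord, hst]

theorem getLast?_pairWord_concat (hst : ∀ b, (w b).head? = some (st b)) (p : β × β)
    (l : List (β × β)) : (pairWord w (l ++ [p])).getLast? = some (st p.2, false) := by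
  simp [pairWord, posWord, FreeGroup.invRev, hst]

theorem isReduced_pairWord (hst : ∀ b, (w b).head? = some (st b))
    (hen : ∀ b, (w b).getLast? = some (en b)) {l : List (β × β)}
    (h1 : ∀ p ∈ l, en p.1 ≠ en p.2) (h2 : l.IsChain fun p q => st p.2 ≠ st q.1) :
    FreeGroup.IsReduced (pairWord w l) := by
  have hpair : ∀ p : β × β, en p.1 ≠ en p.2 →
      FreeGroup.IsReduced (posWord (w p.1) ++ FreeGroup.invRev (posWord (w p.2))) := by
    intro p hp
    rw [FreeGroup.IsReduced, List.isChain_append]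
    refine ⟨isReduced_posWord _, ?_, ?_⟩
    · have := isReduced_posWord (w p.2)
      rw [FreeGroup.isReduced_iff_reduce_eq] at this
      have h3 : FreeGroup.IsReduced (FreeGroup.invRev (posWord (w p.2))) := by
        rw [FreeGroup.isReduced_iff_reduce_eq, FreeGroup.reduce_invRev, this]
      exact h3
    · intro a ha b hb hab
      simp only [posWord, List.getLast?_map, hen, Option.map_some, Option.mem_def,
        Option.some.injEq] at ha
      simp only [posWord, FreeGroup.invRev, List.head?_reverse, List.getLast?_map, hen,
        Option.map_some, Option.mem_def, Option.some.injEq] at hb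
      subst ha hb
      exact absurd hab hp
  induction l with
  | nil => simp [pairWord]
  | cons p l ih =>
    have ih' := ih (fun q hq => h1 q (List.mem_cons_of_mem _ hq)) h2.tail
    rw [pairWord, List.flatMap_cons, FreeGroup.IsReduced, List.isChain_append]
    refine ⟨hpair p (h1 p (by simp)), ih', ?_⟩
    intro a ha b hb hab
    rcases l with _ | ⟨q, l⟩
    · simp at hb
    have hb' : b = (st q.1, true) := by
      have := head?_pairWord_cons hst q l
      rw [pairWord] at this
      rw [this] at hb
      simpa [eq_comm] using hb
    have ha' : a = (st p.2, false) := by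
      have := getLast?_pairWord_concat hst p []
      rw [pairWord] at this
      simp only [List.nil_append, List.flatMap_cons, List.flatMap_nil, List.append_nil] at this
      rw [this] at ha
      simpa [eq_comm] using ha
    subst ha' hb'
    rw [List.isChain_cons_cons] at h2
    exact absurd hab h2.1

/-- In the word of an alternating product no letters cancel, not even cyclically, as the words
`w b` have the prescribed first and last letters. -/
theorem isCyclicallyReduced_pairWord (hst : ∀ b, (w b).head? = some (st b))
    (hen : ∀ b, (w b).getLast? = some (en b)) {l : List (β × β)} (h : Alternating st en l) :
    FreeGroup.IsCyclicallyReduced (pairWord w l) := by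
  rcases l with _ | ⟨p, l⟩
  · simp [pairWord]
  have hc := h.2
  rw [Cycle.chain_coe_cons] at hc
  have hc1 : (p :: l).IsChain fun p q => st p.2 ≠ st q.1 := by
    rw [← List.cons_append] at hc
    exact hc.left_of_append
  refine ⟨isReduced_pairWord hst hen h.1 hc1, ?_⟩
  intro a ha b hb hab
  rw [head?_pairWord_cons hst] at hb
  obtain ⟨m, q, hq⟩ : ∃ m q, p :: l = m ++ [q] := by
    rcases List.eq_nil_or_concat (p :: l) with h | ⟨m, q, h⟩
    · simp at h
    · exact ⟨m, q, by simpa using h⟩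
  rw [hq, getLast?_pairWord_concat hst] at ha
  rw [← List.cons_append, hq, List.append_assoc, List.singleton_append,
    List.isChain_append_cons_cons] at hc
  simp only [Option.mem_def, Option.some.injEq] at ha hb
  subst ha hb
  exact absurd hab hc.2.1

end PairVal

/-! ### Tame elements: loops are decided by a finite state -/

/-- A mixed positive block `c ^ (rep + 1) * d * tail`, where `d` is the letter other than `c`. The
tail is a word over the letters (`Sum.inl c`) and the conjugated letters `conjLetter c`
(`Sum.inr c`). -/
structure Block where
  /-- The first letter of the block. -/
  fst : Fin 2
  /-- One less than the number of copies of the first letter at the beginning of the block. -/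
  rep : ℕ
  /-- What follows the first occurrence of the other letter. -/
  tail : List (Fin 2 ⊕ Fin 2)

/-- The element represented by a word over the letters and the conjugated letters. -/
def tailVal (t : List (Fin 2 ⊕ Fin 2)) : F2 :=
  (t.map (Sum.elim FreeGroup.of conjLetter)).prod

@[simp] theorem tailVal_append (s t : List (Fin 2 ⊕ Fin 2)) :
    tailVal (s ++ t) = tailVal s * tailVal t := by simp [tailVal]

theorem tailVal_replicate_inr (n : ℕ) (c : Fin 2) :
    tailVal (List.replicate n (Sum.inr c)) =
      (FreeGroup.of c)⁻¹ * FreeGroup.of (other c) ^ n * FreeGroup.of c := by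
  induction n with
  | zero => simp [tailVal]
  | succ n ih =>
    rw [List.replicate_succ, ← List.singleton_append, tailVal_append, ih, pow_succ']
    simp only [tailVal, conjLetter, List.map_cons, List.map_nil, Sum.elim_inr, List.prod_cons,
      List.prod_nil]
    group

/-- The element of the free group represented by a block. -/
def Block.val (B : Block) : F2 :=
  FreeGroup.of B.fst ^ (B.rep + 1) * FreeGroup.of (other B.fst) * tailVal B.tail

/-- The last letter of a block; a conjugated letter `c⁻¹ d c` counts as ending in `c`. -/
def Block.last (B : Block) : Fin 2 :=
  (B.tail.getLast?.map (Sum.elim id id)).getD (other B.fst)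

/-- The image of a tail under the automorphism described by the word data `D`. -/
def tailWord (D : WordData) (t : List (Fin 2 ⊕ Fin 2)) : List (Fin 2) :=
  t.flatMap (Sum.elim D.img D.zimg)

/-- The positive word for `P⁻¹ * φ B`, where `D` describes `φ` with conjugator `P`. -/
def Block.word (D : WordData) (B : Block) : List (Fin 2) :=
  (List.replicate B.rep (D.cimg B.fst)).flatten ++ ([B.fst, other B.fst] ++ tailWord D B.tail)

section Describes

variable {D : WordData} {φ : MulAut F2} {P : F2}

theorem Describes.posVal_tailWord (h : Describes D φ P) (t : List (Fin 2 ⊕ Fin 2)) :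
    posVal (tailWord D t) = φ (tailVal t) := by
  induction t with
  | nil => simp [tailWord, tailVal]
  | cons x t ih =>
    rw [tailWord, List.flatMap_cons, ← tailWord, posVal_append, ih]
    rcases x with c | c <;> simp [tailVal, h.img, h.zimg]

theorem Describes.posVal_word (h : Describes D φ P) (B : Block) :
    posVal (B.word D) = P⁻¹ * φ B.val := by
  have hval : B.val = FreeGroup.of B.fst ^ B.rep *
      (FreeGroup.of B.fst * FreeGroup.of (other B.fst)) * tailVal B.tail := by
    rw [Block.val, pow_succ]; group
  have hconj : (P⁻¹ * φ (FreeGroup.of B.fst) * P) ^ B.rep =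
      P⁻¹ * φ (FreeGroup.of B.fst) ^ B.rep * P := by
    simpa using conj_pow (i := B.rep) (a := P⁻¹) (b := φ (FreeGroup.of B.fst))
  rw [Block.word, posVal_append, posVal_append, posVal_replicate_flatten, h.posVal_tailWord,
    h.cimg, hconj, hval, map_mul, map_mul, map_pow, h.pref, posVal_cons, posVal_cons, posVal_nil]
  group

theorem Describes.head?_word (h : Describes D φ P) (B : Block) :
    (B.word D).head? = some B.fst := by
  unfold Block.word
  cases B.rep with
  | zero => simp
  | succ n => simp [List.replicate_succ, h.cimg_head]

theorem Describes.getLast?_word (h : Describes D φ P) (B : Block) :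
    (B.word D).getLast? = some B.last := by
  unfold Block.word Block.last
  rcases List.eq_nil_or_concat B.tail with ht | ⟨t, x, ht⟩
  · simp [ht, tailWord]
  · rw [ht, List.concat_eq_append]
    apply getLast?_append_of_eq_some
    apply getLast?_append_of_eq_some
    rw [tailWord, List.flatMap_append]
    apply getLast?_append_of_eq_some
    rcases x with c | c <;> simp [h.img_last, h.zimg_last]

end Describes

/-- An element is tame if, up to inversion and conjugacy, it is a positive word in the letters and
conjugated letters, or if it is conjugate to an alternating product of mixed blocks. In
both cases the cyclically reduced form of its image under a product of twists is a product of the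
words describing that product. -/
def IsTame (u : F2) : Prop :=
  (∃ t, IsConj u (tailVal t) ∨ IsConj u⁻¹ (tailVal t)) ∨
    ∃ l : List (Block × Block), Alternating Block.fst Block.last l ∧ IsConj u (pairVal Block.val l)

section State

variable {V : Type*} {E : V → Fin 2 → V → Prop}

/-- The pairs of vertices joined by a walk that reads a given positive word. -/
def walkRel (E : V → Fin 2 → V → Prop) (p : List (Fin 2)) : Set (V × V) :=
  {x | Walk E x.1 (posWord p) x.2}

theorem walkRel_append_congr {p p' q q' : List (Fin 2)} (hp : walkRel E p = walkRel E p')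
    (hq : walkRel E q = walkRel E q') : walkRel E (p ++ q) = walkRel E (p' ++ q') := by
  ext ⟨v, w⟩
  have hp' : ∀ v w, Walk E v (posWord p) w ↔ Walk E v (posWord p') w := fun v w =>
    Set.ext_iff.1 hp (v, w)
  have hq' : ∀ v w, Walk E v (posWord q) w ↔ Walk E v (posWord q') w := fun v w =>
    Set.ext_iff.1 hq (v, w)
  simp [walkRel, walk_append, hp', hq']

/-- What a graph remembers of the words describing a product of twists. -/
def graphState (E : V → Fin 2 → V → Prop) (D : WordData) :
    (Fin 2 → Set (V × V)) × (Fin 2 → Set (V × V)) × (Fin 2 → Set (V × V)) :=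
  (fun c => walkRel E (D.img c), fun c => walkRel E (D.cimg c), fun c => walkRel E (D.zimg c))

theorem graphState_eq_iff {D D' : WordData} : graphState E D = graphState E D' ↔
    ∀ c, walkRel E (D.img c) = walkRel E (D'.img c) ∧
      walkRel E (D.cimg c) = walkRel E (D'.cimg c) ∧
      walkRel E (D.zimg c) = walkRel E (D'.zimg c) := by
  simp only [graphState, Prod.mk.injEq, funext_iff]
  exact ⟨fun h c => ⟨h.1 c, h.2.1 c, h.2.2 c⟩,
    fun h => ⟨fun c => (h c).1, fun c => (h c).2.1, fun c => (h c).2.2⟩⟩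

theorem graphState_cons_congr {r r' : List (Fin 2)}
    (h : graphState E (wordData r) = graphState E (wordData r')) (c : Fin 2) :
    graphState E (wordData (c :: r)) = graphState E (wordData (c :: r')) := by
  rw [graphState_eq_iff] at h ⊢
  intro i
  refine ⟨?_, ?_, ?_⟩ <;> simp only [wordData] <;> split_ifs
  · exact (h c).1
  · exact walkRel_append_congr (h c).1 (h i).1
  · exact (h c).2.1
  · exact walkRel_append_congr (h i).2.1 (h c).2.1
  · exact walkRel_append_congr (h _).1 (h c).1
  · exact (h i).2.2

theorem walkRel_tailWord_congr {D D' : WordData} (h : graphState E D = graphState E D')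
    (t : List (Fin 2 ⊕ Fin 2)) : walkRel E (tailWord D t) = walkRel E (tailWord D' t) := by
  rw [graphState_eq_iff] at h
  induction t with
  | nil => rfl
  | cons x t ih =>
    refine walkRel_append_congr ?_ ih
    rcases x with c | c
    · exact (h c).1
    · exact (h c).2.2

theorem walkRel_word_congr {D D' : WordData} (h : graphState E D = graphState E D')
    (B : Block) : walkRel E (B.word D) = walkRel E (B.word D') := by
  refine walkRel_append_congr ?_ (walkRel_append_congr rfl (walkRel_tailWord_congr h _))
  induction B.rep with
  | zero => rfl
  | succ n ih =>
    rw [List.replicate_succ, List.replicate_succ, List.flatten_cons, List.flatten_cons]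
    exact walkRel_append_congr ((graphState_eq_iff.1 h) _).2.1 ih

theorem walk_pairWord_congr {β : Type*} {w w' : β → List (Fin 2)}
    (h : ∀ b, walkRel E (w b) = walkRel E (w' b)) (l : List (β × β)) {v z : V} :
    Walk E v (pairWord w l) z ↔ Walk E v (pairWord w' l) z := by
  have h' : ∀ b v z, Walk E v (posWord (w b)) z ↔ Walk E v (posWord (w' b)) z := fun b v z =>
    Set.ext_iff.1 (h b) (v, z)
  induction l generalizing v with
  | nil => rfl
  | cons p l ih =>
    simp only [pairWord, List.flatMap_cons, walk_append, walk_invRev, h'] at ih ⊢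
    simp only [ih]

theorem hasLoop_codeAut_tailVal_congr (hE : Folded E) {r r' : List (Fin 2)}
    (hs : graphState E (wordData r) = graphState E (wordData r')) {t : List (Fin 2 ⊕ Fin 2)}
    (h : HasLoop E (codeAut r (tailVal t))) : HasLoop E (codeAut r' (tailVal t)) := by
  obtain ⟨P, hP⟩ := exists_describes_wordData r
  obtain ⟨P', hP'⟩ := exists_describes_wordData r'
  rw [← hP.posVal_tailWord] at h
  obtain ⟨v, hv⟩ := exists_walk_of_hasLoop_mk hE (isCyclicallyReduced_posWord _) h
  refine ⟨v, posWord (tailWord (wordData r') t), ?_, ?_⟩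
  · rw [← hP'.posVal_tailWord]
    exact IsConj.refl _
  · exact (Set.ext_iff.1 (walkRel_tailWord_congr hs t) (v, v)).1 hv

theorem isConj_codeAut_pairVal (r : List (Fin 2)) (l : List (Block × Block)) :
    IsConj (FreeGroup.mk (pairWord (Block.word (wordData r)) l))
      (codeAut r (pairVal Block.val l)) := by
  obtain ⟨P, hP⟩ := exists_describes_wordData r
  refine isConj_iff.2 ⟨P, ?_⟩
  rw [mk_pairWord]
  induction l with
  | nil => simp
  | cons p l ih =>
    rw [pairVal_cons, pairVal_cons, hP.posVal_word, hP.posVal_word, map_mul, ← ih, map_mul, map_inv]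
    group

/-- Whether a product of twists sends a tame element to the label of a closed walk depends only on
the state of the product. -/
theorem IsTame.hasLoop_congr (hE : Folded E) {u : F2} (hu : IsTame u) {r r' : List (Fin 2)}
    (hs : graphState E (wordData r) = graphState E (wordData r'))
    (h : HasLoop E (codeAut r u)) : HasLoop E (codeAut r' u) := by
  have hmap : ∀ (r : List (Fin 2)) {x y : F2}, IsConj x y → IsConj (codeAut r x) (codeAut r y) :=
    fun r x y hxy => (codeAut r).toMonoidHom.map_isConj hxy
  rcases hu with ⟨t, ht | ht⟩ | ⟨l, hl, hc⟩
  · exact (hasLoop_codeAut_tailVal_congr hE hs (h.conj (hmap r ht))).conj (hmap r' ht).symm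
  · have h1 := h.inv
    rw [← map_inv] at h1
    have h2 := ((hasLoop_codeAut_tailVal_congr hE hs (h1.conj (hmap r ht))).conj
      (hmap r' ht).symm).inv
    rwa [map_inv, inv_inv] at h2
  · obtain ⟨P, hP⟩ := exists_describes_wordData r
    have h1 := (h.conj (hmap r hc)).conj (isConj_codeAut_pairVal r l).symm
    obtain ⟨v, hv⟩ := exists_walk_of_hasLoop_mk hE
      (isCyclicallyReduced_pairWord hP.head?_word hP.getLast?_word hl) h1
    exact ⟨v, _, (isConj_codeAut_pairVal r' l).trans (hmap r' hc).symm,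
      (walk_pairWord_congr (walkRel_word_congr hs) l).1 hv⟩

end State

/-! ### Shortening products of twists -/

/-- A deterministic automaton with finitely many states reaches each of its reachable states by a
word no longer than the number of states. -/
theorem exists_length_le_card_of_cons_congr {α S : Type*} [Finite S] (σ : List α → S)
    (hσ : ∀ c r r', σ r = σ r' → σ (c :: r) = σ (c :: r')) (r : List α) :
    ∃ r', r'.length ≤ Nat.card S ∧ σ r' = σ r := by
  have happ : ∀ p r r', σ r = σ r' → σ (p ++ r) = σ (p ++ r') := by
    intro p r r' h
    induction p with
    | nil => exact h
    | cons c p ih => exact hσ c _ _ ih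
  induction hn : r.length using Nat.strong_induction_on generalizing r with
  | _ n ih =>
    by_cases hle : n ≤ Nat.card S
    · exact ⟨r, hn ▸ hle, rfl⟩
    have : Fintype S := Fintype.ofFinite S
    rw [Nat.card_eq_fintype_card] at hle
    -- two suffixes of a long word lead to the same state; the part between them is left out
    obtain ⟨i, j, hij, heq⟩ := Fintype.exists_ne_map_eq_of_card_lt
      (fun i : Fin n => σ (r.drop i)) (by simpa using hle)
    wlog hlt : i < j generalizing i j
    · exact this j i hij.symm heq.symm (lt_of_le_of_ne (not_lt.1 hlt) hij.symm)
    have h1 : σ (r.take i ++ r.drop j) = σ r := by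
      rw [happ _ _ _ heq.symm, List.take_append_drop]
    have hlen : (r.take i ++ r.drop j).length < n := by
      have := i.2; have := j.2; have : (i : ℕ) < j := hlt
      simp only [List.length_append, List.length_take, List.length_drop]
      omega
    obtain ⟨r', h2, h3⟩ := ih _ hlen _ rfl
    exact ⟨r', h2, h3.trans h1⟩

/-- The element `u` becomes tame after at most `k` twists, however these are chosen. -/
def TameWithin : ℕ → F2 → Prop
  | 0, u => IsTame u
  | k + 1, u => IsTame u ∨ ∀ c, TameWithin k (twist c u)

theorem IsTame.tameWithin {u : F2} (h : IsTame u) (k : ℕ) : TameWithin k u := by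
  cases k with
  | zero => exact h
  | succ k => exact Or.inl h

theorem TameWithin.mono {k m : ℕ} {u : F2} (h : TameWithin k u) (hkm : k ≤ m) :
    TameWithin m u := by
  induction k generalizing m u with
  | zero => exact h.tameWithin m
  | succ k ih =>
    obtain ⟨m, rfl⟩ : ∃ m', m = m' + 1 := ⟨m - 1, by omega⟩
    rcases h with h | h
    · exact Or.inl h
    · exact Or.inr fun c => ih (h c) (by omega)

theorem IsTame.of_isConj {u v : F2} (h : IsTame v) (huv : IsConj u v) : IsTame u := by
  rcases h with ⟨t, h | h⟩ | ⟨l, hl, h⟩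
  · exact Or.inl ⟨t, Or.inl (huv.trans h)⟩
  · refine Or.inl ⟨t, Or.inr (IsConj.trans ?_ h)⟩
    obtain ⟨c, rfl⟩ := isConj_iff.1 huv
    exact isConj_iff.2 ⟨c, by group⟩
  · exact Or.inr ⟨l, hl, huv.trans h⟩

theorem TameWithin.of_isConj {k : ℕ} {u v : F2} (h : TameWithin k v) (huv : IsConj u v) :
    TameWithin k u := by
  induction k generalizing u v with
  | zero => exact IsTame.of_isConj h huv
  | succ k ih =>
    rcases h with h | h
    · exact Or.inl (h.of_isConj huv)
    · exact Or.inr fun c => ih (h c) ((twist c).toMonoidHom.map_isConj huv)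

/-- If some product of twists sends `u` to the label of a closed walk in a finite folded graph,
then so does a product of bounded length. -/
theorem TameWithin.exists_short {V : Type*} [Finite V] {E : V → Fin 2 → V → Prop} (hE : Folded E)
    {k : ℕ} {u : F2} (hu : TameWithin k u) {r : List (Fin 2)} (h : HasLoop E (codeAut r u)) :
    ∃ r' : List (Fin 2), r'.length ≤ k + (2 ^ Nat.card V ^ 2) ^ 6 ∧
      HasLoop E (codeAut r' u) := by
  have htame : ∀ {u : F2} {r : List (Fin 2)}, IsTame u → HasLoop E (codeAut r u) →
      ∃ r' : List (Fin 2), r'.length ≤ (2 ^ Nat.card V ^ 2) ^ 6 ∧ HasLoop E (codeAut r' u) := by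
    intro u r hu h
    obtain ⟨r', h1, h2⟩ := exists_length_le_card_of_cons_congr
      (fun r => graphState E (wordData r)) (fun c r r' h => graphState_cons_congr h c) r
    refine ⟨r', h1.trans (le_of_eq ?_), hu.hasLoop_congr hE h2.symm h⟩
    have : Fintype V := Fintype.ofFinite V
    classical
    simp only [Nat.card_eq_fintype_card, Fintype.card_prod, Fintype.card_pi, Fintype.card_set,
      Finset.prod_const, Finset.card_univ, Fintype.card_fin]
    ring
  induction k generalizing u r with
  | zero =>
    obtain ⟨r', h1, h2⟩ := htame hu h
    exact ⟨r', by omega, h2⟩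
  | succ k ih =>
    rcases hu with hu | hu
    · obtain ⟨r', h1, h2⟩ := htame hu h
      exact ⟨r', by omega, h2⟩
    · rcases r with _ | ⟨c, r⟩
      · exact ⟨[], by simp, h⟩
      · obtain ⟨r', h1, h2⟩ := ih (hu c) (r := r) h
        exact ⟨c :: r', by simp only [List.length_cons]; omega, h2⟩

/-! ### Cyclic lists of pairs -/

section CyclicLists

variable {α : Type*} {l : List α}

theorem exists_isRotated_cons_of_mem {p : α} (h : p ∈ l) : ∃ m, l ~r p :: m := by
  obtain ⟨l₁, l₂, rfl⟩ := List.append_of_mem h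
  exact ⟨l₂ ++ l₁, List.isRotated_append⟩

/-- A relation failing somewhere along a cyclic list fails between the first two entries of some
rotation, unless the list has a single entry. -/
theorem exists_isRotated_of_not_chain {r : α → α → Prop} (h : ¬ Cycle.Chain r (l : Cycle α)) :
    (∃ p q m, l ~r p :: q :: m ∧ ¬ r p q) ∨ ∃ p, l = [p] ∧ ¬ r p p := by
  rcases l with _ | ⟨a, l⟩
  · exact absurd (Cycle.Chain.nil r) h
  rw [Cycle.chain_coe_cons, List.isChain_iff_forall_rel_of_append_cons_cons] at h
  push Not at h
  obtain ⟨x, y, l₁, l₂, heq, hr⟩ := h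
  rcases List.eq_nil_or_concat l₂ with rfl | ⟨l₂, b, rfl⟩
  · obtain ⟨h1, h2⟩ : a :: l = l₁ ++ [x] ∧ [a] = [y] :=
      List.append_inj' (by simpa using heq) rfl
    obtain rfl : a = y := by simpa using h2
    rcases l₁ with _ | ⟨b, l₁⟩
    · obtain ⟨rfl, rfl⟩ : a = x ∧ l = [] := by simpa using h1
      exact Or.inr ⟨a, rfl, hr⟩
    · obtain ⟨rfl, rfl⟩ : a = b ∧ l = l₁ ++ [x] := by simpa using h1
      refine Or.inl ⟨x, a, l₁, ?_, hr⟩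
      exact List.isRotated_append (l := a :: l₁) (l' := [x])
  · have h1 : (a :: l) ++ [a] = (l₁ ++ x :: y :: l₂) ++ [b] := by simpa using heq
    obtain ⟨h1, -⟩ := List.append_inj' h1 rfl
    rw [h1]
    exact Or.inl ⟨x, y, l₂ ++ l₁, List.isRotated_append, hr⟩

theorem isChain_cons_concat_congr {f g : α → Fin 2} {p p' q q' : α}
    (h : (q :: (l ++ [p])).IsChain fun a b => f a ≠ g b) (hq : f q' = f q) (hp : g p' = g p) :
    (q' :: (l ++ [p'])).IsChain fun a b => f a ≠ g b := by
  induction l generalizing q q' with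
  | nil => simpa [hq, hp] using h
  | cons a l ih =>
    simp only [List.cons_append, List.isChain_cons_cons] at h ⊢
    exact ⟨by rw [hq]; exact h.1, ih h.2 rfl⟩

theorem exists_map_subtype {β : Type*} {P : β → Prop} {l : List (β × β)}
    (h : ∀ p ∈ l, P p.1 ∧ P p.2) :
    ∃ l' : List ({b // P b} × {b // P b}), l'.map (Prod.map Subtype.val Subtype.val) = l := by
  induction l with
  | nil => exact ⟨[], rfl⟩
  | cons p l ih =>
    obtain ⟨l', hl'⟩ := ih fun q hq => h q (List.mem_cons_of_mem _ hq)
    exact ⟨(⟨p.1, (h p (by simp)).1⟩, ⟨p.2, (h p (by simp)).2⟩) :: l', by simp [hl']⟩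

end CyclicLists

/-! ### Absorbing single-letter blocks -/

section Merge

variable {e : Fin 2}

/-- The block for `B * e⁻¹ * B'`, where `B'` starts with the letter other than `e`: the inverse
letter is absorbed by conjugated letters. -/
def Block.merge (e : Fin 2) (B B' : Block) : Block :=
  ⟨B.fst, B.rep, B.tail ++ (List.replicate (B'.rep + 1) (Sum.inr e) ++ B'.tail)⟩

theorem Block.inv_mul_val {B : Block} (hB : B.fst = other e) :
    (FreeGroup.of e)⁻¹ * B.val =
      tailVal (List.replicate (B.rep + 1) (Sum.inr e) ++ B.tail) := by
  rw [tailVal_append, tailVal_replicate_inr, Block.val, hB, other_other]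
  group

theorem Block.val_merge {B B' : Block} (hB' : B'.fst = other e) :
    (B.merge e B').val = B.val * (FreeGroup.of e)⁻¹ * B'.val := by
  rw [mul_assoc, Block.inv_mul_val hB', Block.merge, Block.val, tailVal_append, Block.val]
  group

theorem Block.last_merge {B B' : Block} (hB' : B'.fst = other e) :
    (B.merge e B').last = B'.last := by
  unfold Block.last Block.merge
  rcases List.eq_nil_or_concat B'.tail with ht | ⟨t, x, ht⟩
  · simp [ht, hB', List.replicate_succ']
  · simp [ht]

/-- The first letter of a mixed block or, for `none`, of the single letter `e`. -/
def optFst (e : Fin 2) (x : Option Block) : Fin 2 := x.elim e Block.fst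

/-- The last letter of a mixed block or, for `none`, of the single letter `e`. -/
def optLast (e : Fin 2) (x : Option Block) : Fin 2 := x.elim e Block.last

/-- The value of a mixed block or, for `none`, of the single letter `e`. -/
def optVal (e : Fin 2) (x : Option Block) : F2 := x.elim (FreeGroup.of e) Block.val

theorem exists_eq_some_of_optLast_ne {x : Option Block} (h : optLast e x ≠ e) :
    ∃ B, x = some B := by
  cases x with
  | none => exact absurd rfl h
  | some B => exact ⟨B, rfl⟩

theorem exists_eq_some_of_optFst_ne {x : Option Block} (h : optFst e x ≠ e) :
    ∃ B, x = some B ∧ B.fst = other e := by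
  cases x with
  | none => exact absurd rfl h
  | some B => exact ⟨B, rfl, eq_other_of_ne h⟩

/-- Merging two neighbouring pairs keeps a list alternating if the new pair has the outer letters
of the old ones. -/
theorem Alternating.merge {β : Type*} {st en : β → Fin 2} {p q p' : β × β} {m : List (β × β)}
    (h : Alternating st en (p :: q :: m)) (hp' : en p'.1 ≠ en p'.2) (h1 : st p'.1 = st p.1)
    (h2 : st p'.2 = st q.2) : Alternating st en (p' :: m) := by
  refine ⟨?_, ?_⟩
  · intro a ha
    rcases List.mem_cons.1 ha with rfl | ha
    · exact hp'
    · exact h.1 a (by simp [ha])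
  · have hc := h.2
    rw [Cycle.chain_coe_cons] at hc ⊢
    rw [List.cons_append, List.isChain_cons_cons] at hc
    exact isChain_cons_concat_congr (f := fun p : β × β => st p.2)
      (g := fun p : β × β => st p.1) hc.2 h2 h1

/-- An alternating product of mixed blocks and copies of one single letter is tame: the copies of
the letter are absorbed into conjugated letters. -/
theorem isTame_pairVal_optVal (l : List (Option Block × Option Block))
    (hl : Alternating (optFst e) (optLast e) l) : IsTame (pairVal (optVal e) l) := by
  induction hn : l.length using Nat.strong_induction_on generalizing l with
  | _ n ih =>
  -- an inverse letter `e⁻¹` is merged with the blocks before and after it, which are different from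
  -- `e`; if there is just one block `B`, then `B e⁻¹` is conjugate to `e⁻¹ B`, which is a product
  -- of letters and conjugated letters
  by_cases h2 : ∃ p ∈ l, p.2 = none
  · obtain ⟨⟨x, _⟩, hp, rfl⟩ := h2
    obtain ⟨m, hm⟩ := exists_isRotated_cons_of_mem hp
    have hlm := hl.rotate hm
    refine IsTame.of_isConj ?_ (isConj_pairVal_rotate hm)
    obtain ⟨B, rfl⟩ := exists_eq_some_of_optLast_ne (hlm.1 _ List.mem_cons_self)
    have hc := hlm.2
    rcases m with _ | ⟨⟨y, z⟩, m⟩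
    · rw [Cycle.chain_singleton] at hc
      have hB : B.fst = other e := eq_other_of_ne hc.symm
      refine Or.inl ⟨List.replicate (B.rep + 1) (Sum.inr e) ++ B.tail, Or.inl ?_⟩
      rw [← Block.inv_mul_val hB]
      simpa [optVal] using isConj_mul_comm B.val (FreeGroup.of e)⁻¹
    · rw [Cycle.chain_coe_cons, List.cons_append, List.isChain_cons_cons] at hc
      obtain ⟨B', rfl, hB'⟩ := exists_eq_some_of_optFst_ne hc.1.symm
      have hmerge := ih (m.length + 1) (by rw [← hn, hm.perm.length_eq]; simp)
        ((some (B.merge e B'), z) :: m)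
        (hlm.merge (by
          have := hlm.1 (some B', z) (by simp)
          simpa [optLast, Block.last_merge hB'] using this) rfl rfl) rfl
      convert hmerge using 1
      simp [optVal, Block.val_merge hB', mul_assoc]
  -- the letter `e` itself is merged likewise with the inverses of its neighbours
  by_cases h1 : ∃ p ∈ l, p.1 = none
  · obtain ⟨⟨_, z⟩, hp, rfl⟩ := h1
    obtain ⟨m, hm⟩ := exists_isRotated_cons_of_mem hp
    obtain ⟨B, rfl⟩ := exists_eq_some_of_optLast_ne ((hl.rotate hm).1 _ List.mem_cons_self).symm
    rcases List.eq_nil_or_concat m with rfl | ⟨m, ⟨x, y⟩, rfl⟩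
    · have hc := (hl.rotate hm).2
      rw [Cycle.chain_singleton] at hc
      have hB : B.fst = other e := eq_other_of_ne hc
      refine IsTame.of_isConj ?_ (isConj_pairVal_rotate hm)
      refine Or.inl ⟨List.replicate (B.rep + 1) (Sum.inr e) ++ B.tail, Or.inr ?_⟩
      rw [← Block.inv_mul_val hB]
      simpa [optVal] using isConj_mul_comm B.val (FreeGroup.of e)⁻¹
    · have hm' : l ~r (x, y) :: (none, some B) :: m := by
        refine hm.trans ?_
        rw [List.concat_eq_append, ← List.cons_append]
        exact List.isRotated_append
      have hlm := hl.rotate hm'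
      refine IsTame.of_isConj ?_ (isConj_pairVal_rotate hm')
      have hc := hlm.2
      rw [Cycle.chain_coe_cons, List.cons_append, List.isChain_cons_cons] at hc
      obtain ⟨B', rfl, hB'⟩ := exists_eq_some_of_optFst_ne hc.1
      have hmerge := ih (m.length + 1) (by rw [← hn, hm'.perm.length_eq]; simp)
        ((x, some (B.merge e B')) :: m)
        (hlm.merge (by
          have := hlm.1 (x, some B') (by simp)
          simpa [optLast, Block.last_merge hB'] using this) rfl rfl) rfl
      convert hmerge using 1
      simp [optVal, Block.val_merge hB', mul_assoc]
  · have hsome : ∀ p ∈ l, p.1.isSome ∧ p.2.isSome := by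
      intro p hp
      constructor
      · exact Option.isSome_iff_ne_none.2 fun h => h1 ⟨p, hp, h⟩
      · exact Option.isSome_iff_ne_none.2 fun h => h2 ⟨p, hp, h⟩
    obtain ⟨l', rfl⟩ := exists_map_subtype (P := fun x : Option Block => x.isSome) hsome
    choose g hg using fun x : {x : Option Block // x.isSome} => Option.isSome_iff_exists.1 x.2
    rw [alternating_map] at hl
    simp only [hg] at hl
    refine Or.inr ⟨l'.map (Prod.map g g), (alternating_map g l').2 hl, ?_⟩
    rw [pairVal_map, pairVal_map]
    simp only [hg]
    exact IsConj.refl _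

end Merge

/-! ### Positive blocks under a twist -/

/-- The element with positive word `p` as a tail. -/
theorem tailVal_map_inl (p : List (Fin 2)) : tailVal (p.map Sum.inl) = posVal p := by
  induction p with
  | nil => rfl
  | cons c p ih =>
    rw [posVal_cons, ← ih]
    simp [tailVal]

theorem isTame_posVal (p : List (Fin 2)) : IsTame (posVal p) :=
  Or.inl ⟨p.map Sum.inl, Or.inl (by rw [tailVal_map_inl])⟩

theorem isTame_posVal_inv (p : List (Fin 2)) : IsTame (posVal p)⁻¹ :=
  Or.inl ⟨p.map Sum.inl, Or.inr (by rw [tailVal_map_inl, inv_inv])⟩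

/-- A positive word is mixed if both letters occur in it. -/
def Mixed (w : List (Fin 2)) : Prop := 0 ∈ w ∧ 1 ∈ w

theorem mixed_iff {w : List (Fin 2)} (c : Fin 2) : Mixed w ↔ c ∈ w ∧ other c ∈ w := by
  fin_cases c
  · rfl
  · exact and_comm

theorem exists_eq_replicate_append {c : Fin 2} {w : List (Fin 2)} (h : other c ∈ w) :
    ∃ i t, c :: w = List.replicate (i + 1) c ++ other c :: t := by
  induction w with
  | nil => simp at h
  | cons d w ih =>
    by_cases hd : d = c
    · subst hd
      obtain ⟨i, t, ht⟩ := ih (by simpa [other_ne] using h)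
      exact ⟨i + 1, t, by rw [ht, List.replicate_succ (n := i + 1)]; rfl⟩
    · exact ⟨0, w, by rw [eq_other_of_ne hd]; rfl⟩

/-- A word that is mixed or consists of the single letter `e`, as an optional block. -/
theorem exists_optVal_eq_posVal {e : Fin 2} {w : List (Fin 2)} (hw : Mixed w ∨ w = [e]) :
    ∃ x : Option Block, optVal e x = posVal w ∧ w.head? = some (optFst e x) ∧
      w.getLast? = some (optLast e x) := by
  rcases hw with hw | rfl
  · rcases w with _ | ⟨c, w⟩
    · simp [Mixed] at hw
    rw [mixed_iff c] at hw
    obtain ⟨i, t, ht⟩ := exists_eq_replicate_append (c := c) (w := w)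
      (by simpa [other_ne] using hw.2)
    refine ⟨some ⟨c, i, t.map Sum.inl⟩, ?_, by simp [optFst], ?_⟩
    · have hrep : posVal (List.replicate (i + 1) c) = FreeGroup.of c ^ (i + 1) := by
        have := posVal_replicate_flatten (i + 1) [c]
        simpa [posVal_cons] using this
      rw [ht, posVal_append, posVal_cons, hrep]
      simp [optVal, Block.val, tailVal_map_inl, mul_assoc]
    · rw [ht, List.getLast?_append]
      rcases List.eq_nil_or_concat t with rfl | ⟨t, d, rfl⟩
      · simp [optLast, Block.last]
      · simp [optLast, Block.last, List.getLast?_cons]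
  · exact ⟨none, by simp [optVal, posVal_cons], rfl, rfl⟩

/-- An alternating product of positive words is tame if all of them are mixed or equal to one fixed
letter. -/
theorem isTame_pairVal_posVal {e : Fin 2} {l : List (List (Fin 2) × List (Fin 2))}
    (hl : Alternating List.head? List.getLast? l)
    (he : ∀ p ∈ l, (Mixed p.1 ∨ p.1 = [e]) ∧ (Mixed p.2 ∨ p.2 = [e])) :
    IsTame (pairVal posVal l) := by
  obtain ⟨l', rfl⟩ := exists_map_subtype (P := fun w => Mixed w ∨ w = [e]) he
  choose g hg1 hg2 hg3 using
    fun w : {w : List (Fin 2) // Mixed w ∨ w = [e]} => exists_optVal_eq_posVal w.2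
  have := isTame_pairVal_optVal (e := e) (l'.map (Prod.map g g)) (by
    rw [alternating_map] at hl ⊢
    simp only [hg2, hg3] at hl
    refine ⟨fun p hp h => hl.1 p hp (congrArg some h), hl.2.imp fun p q hpq h => ?_⟩
    exact hpq (congrArg some h))
  rw [pairVal_map] at this ⊢
  simpa only [hg1] using this

/-- The image of a positive word under `twist c`, without its first letter `c`. -/
def trim (c : Fin 2) (w : List (Fin 2)) : List (Fin 2) :=
  (w.flatMap fun i => if i = c then [c] else [c, i]).tail

theorem posVal_flatMap_twist (c : Fin 2) (w : List (Fin 2)) :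
    posVal (w.flatMap fun i => if i = c then [c] else [c, i]) = twist c (posVal w) := by
  induction w with
  | nil => simp
  | cons d w ih =>
    rw [List.flatMap_cons, posVal_append, ih, posVal_cons, map_mul]
    congr 1
    by_cases hd : d = c
    · subst hd; simp [posVal_cons]
    · rw [if_neg hd, eq_other_of_ne hd]; simp [posVal_cons]

theorem trim_cons_self (c : Fin 2) (w : List (Fin 2)) :
    trim c (c :: w) = w.flatMap fun i => if i = c then [c] else [c, i] := by simp [trim]

theorem trim_cons_other (c : Fin 2) (w : List (Fin 2)) : trim c (other c :: w) =
    other c :: w.flatMap fun i => if i = c then [c] else [c, i] := by simp [trim, other_ne]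

theorem eq_or_eq_other (c d : Fin 2) : d = c ∨ d = other c := by
  by_cases h : d = c
  · exact Or.inl h
  · exact Or.inr (eq_other_of_ne h)

theorem posVal_trim (c : Fin 2) {w : List (Fin 2)} (hw : w ≠ []) :
    posVal (trim c w) = (FreeGroup.of c)⁻¹ * twist c (posVal w) := by
  rcases w with _ | ⟨d, w⟩
  · exact absurd rfl hw
  rcases eq_or_eq_other c d with rfl | rfl
  · rw [trim_cons_self, posVal_flatMap_twist, posVal_cons, map_mul, twist_of]; group
  · rw [trim_cons_other, posVal_cons, posVal_flatMap_twist, posVal_cons, map_mul,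
      twist_of_other]
    group

theorem getLast?_flatMap_twist (c : Fin 2) (w : List (Fin 2)) :
    (w.flatMap fun i => if i = c then [c] else [c, i]).getLast? = w.getLast? := by
  rcases List.eq_nil_or_concat w with rfl | ⟨w, d, rfl⟩
  · rfl
  · rw [List.concat_eq_append, List.flatMap_append]
    rw [getLast?_append_of_eq_some (c := d), getLast?_append_of_eq_some (c := d)]
    · rfl
    · by_cases hd : d = c <;> simp [hd]

theorem getLast?_trim {c : Fin 2} {w : List (Fin 2)} (hw : trim c w ≠ []) :
    (trim c w).getLast? = w.getLast? := by
  rcases w with _ | ⟨d, w⟩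
  · rfl
  rcases eq_or_eq_other c d with rfl | rfl
  · rw [trim_cons_self] at hw ⊢
    rw [getLast?_flatMap_twist]
    rcases w with _ | ⟨x, w⟩
    · simp at hw
    · simp [List.getLast?_cons]
  · rw [trim_cons_other, List.getLast?_cons, List.getLast?_cons, getLast?_flatMap_twist]

theorem head?_trim {c : Fin 2} {w : List (Fin 2)} (hw : trim c w ≠ []) :
    (trim c w).head? = w.head? := by
  rcases w with _ | ⟨d, w⟩
  · rfl
  rcases eq_or_eq_other c d with rfl | rfl
  · rw [trim_cons_self] at hw ⊢
    rcases w with _ | ⟨x, w⟩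
    · simp at hw
    · by_cases hx : x = d <;> simp [hx]
  · rw [trim_cons_other]; rfl

theorem length_trim_le (c : Fin 2) (w : List (Fin 2)) : (trim c w).length ≤ 2 * w.length := by
  have h : (w.flatMap fun i => if i = c then [c] else [c, i]).length ≤ 2 * w.length := by
    induction w with
    | nil => simp
    | cons d w ih =>
      rw [List.flatMap_cons, List.length_append, List.length_cons]
      split_ifs <;> simp only [List.length_cons, List.length_nil] <;> omega
  rw [trim, List.length_tail]
  omega

open Classical in
/-- The length of a positive word if it is not mixed, and zero if it is. -/
noncomputable def pureSize (w : List (Fin 2)) : ℕ := if Mixed w then 0 else w.length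

theorem pureSize_le (w : List (Fin 2)) : pureSize w ≤ w.length := by
  unfold pureSize; split_ifs <;> simp

theorem mem_flatMap_twist {c : Fin 2} {w : List (Fin 2)} (hw : w ≠ []) :
    c ∈ w.flatMap fun i => if i = c then [c] else [c, i] := by
  rcases w with _ | ⟨d, w⟩
  · exact absurd rfl hw
  · by_cases hd : d = c <;> simp [hd]

theorem mem_flatMap_twist_of_mem {c d : Fin 2} {w : List (Fin 2)} (hw : d ∈ w) :
    d ∈ w.flatMap fun i => if i = c then [c] else [c, i] := by
  rw [List.mem_flatMap]
  refine ⟨d, hw, ?_⟩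
  by_cases hd : d = c <;> simp [hd]

theorem Mixed.trim {w : List (Fin 2)} (h : Mixed w) (c : Fin 2) : Mixed (trim c w) := by
  rw [mixed_iff c] at h ⊢
  rcases w with _ | ⟨d, w⟩
  · simp at h
  rcases eq_or_eq_other c d with rfl | rfl
  · have : other d ∈ w := by simpa [other_ne] using h.2
    rw [trim_cons_self]
    exact ⟨mem_flatMap_twist (List.ne_nil_of_mem this), mem_flatMap_twist_of_mem this⟩
  · have : c ∈ w := by simpa [(other_ne c).symm] using h.1
    rw [trim_cons_other]
    exact ⟨List.mem_cons_of_mem _ (mem_flatMap_twist_of_mem this), List.mem_cons_self⟩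

theorem pureSize_trim_lt {c : Fin 2} {w : List (Fin 2)} (hw : w ≠ []) (hm : ¬ Mixed w)
    (hc : w ≠ [other c]) : pureSize (trim c w) < pureSize w := by
  have hsize : pureSize w = w.length := by simp [pureSize, hm]
  rw [hsize]
  rcases w with _ | ⟨d, w⟩
  · exact absurd rfl hw
  rw [mixed_iff c] at hm
  rcases eq_or_eq_other c d with rfl | rfl
  · have hall : ∀ i ∈ w, i = d := by
      intro i hi
      rcases eq_or_eq_other d i with h | h
      · exact h
      · exact absurd ⟨List.mem_cons_self, List.mem_cons_of_mem _ (h ▸ hi)⟩ hm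
    have hlen : (trim d (d :: w)).length = w.length := by
      rw [trim_cons_self, List.length_flatMap]
      have : w.map (fun i => (if i = d then [d] else [d, i]).length) = w.map fun _ => 1 :=
        List.map_congr_left fun i hi => by simp [hall i hi]
      rw [this]
      simp
    have := pureSize_le (trim d (d :: w))
    simp only [List.length_cons]
    omega
  · have hmixed : Mixed (trim c (other c :: w)) := by
      rw [mixed_iff c, trim_cons_other]
      refine ⟨List.mem_cons_of_mem _ (mem_flatMap_twist ?_), List.mem_cons_self⟩
      rintro rfl
      exact hc rfl
    simp [pureSize, hmixed]

theorem pureSize_trim_le {c : Fin 2} {w : List (Fin 2)} (hw : w ≠ []) :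
    pureSize (trim c w) ≤ pureSize w := by
  by_cases hm : Mixed w
  · simp [pureSize, hm.trim c]
  by_cases hc : w = [other c]
  · subst hc
    rw [trim_cons_other]
    exact le_of_eq (congrArg _ (by simp))
  · exact (pureSize_trim_lt hw hm hc).le

/-! ### Every element becomes tame after boundedly many twists -/

/-- The total length of the words in a list of pairs. -/
def pairSize (l : List (List (Fin 2) × List (Fin 2))) : ℕ :=
  (l.map fun p => p.1.length + p.2.length).sum

/-- The total length of the words in a list of pairs that are not mixed. -/
noncomputable def pairPureSize (l : List (List (Fin 2) × List (Fin 2))) : ℕ :=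
  (l.map fun p => pureSize p.1 + pureSize p.2).sum

theorem pairSize_cons (p : List (Fin 2) × List (Fin 2)) (l : List (List (Fin 2) × List (Fin 2))) :
    pairSize (p :: l) = p.1.length + p.2.length + pairSize l := by simp [pairSize]

theorem pairSize_rotate {l m : List (List (Fin 2) × List (Fin 2))} (h : l ~r m) :
    pairSize l = pairSize m := (h.perm.map _).sum_eq

/-- A product of pairs with an empty word is tame or can be written with fewer pairs. -/
theorem isTame_or_exists_shorter {l : List (List (Fin 2) × List (Fin 2))}
    (h : ∃ p ∈ l, p.1 = [] ∨ p.2 = []) :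
    IsTame (pairVal posVal l) ∨ ∃ l', l'.length < l.length ∧ pairSize l' = pairSize l ∧
      IsConj (pairVal posVal l) (pairVal posVal l') := by
  obtain ⟨⟨x, y⟩, hp, hxy⟩ := h
  obtain ⟨m, hm⟩ := exists_isRotated_cons_of_mem hp
  have hconj := isConj_pairVal_rotate (f := posVal) hm
  have hsize := pairSize_rotate hm
  have hlen := hm.perm.length_eq
  rcases hxy with rfl | rfl
  · rcases List.eq_nil_or_concat m with rfl | ⟨m, ⟨z, w⟩, rfl⟩
    · refine Or.inl (IsTame.of_isConj ?_ hconj)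
      simpa using isTame_posVal_inv y
    · refine Or.inr ⟨(z, y ++ w) :: m, by simp [hlen], ?_, ?_⟩
      · rw [hsize]; simp [pairSize]; omega
      · refine hconj.trans ?_
        rw [List.concat_eq_append, ← List.cons_append]
        refine (isConj_pairVal_rotate List.isRotated_append).trans ?_
        simp only [List.singleton_append, pairVal_cons, posVal_append, posVal_nil]
        convert IsConj.refl _ using 1
        group
  · rcases m with _ | ⟨⟨z, w⟩, m⟩
    · refine Or.inl (IsTame.of_isConj ?_ hconj)
      simpa using isTame_posVal x
    · refine Or.inr ⟨(x ++ z, w) :: m, by simp [hlen], ?_, ?_⟩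
      · rw [hsize]; simp [pairSize]; omega
      · refine hconj.trans ?_
        convert IsConj.refl _ using 1
        simp [mul_assoc]

theorem eq_concat_of_getLast? {w : List (Fin 2)} {c : Fin 2} (h : w.getLast? = some c) :
    ∃ x, w = x ++ [c] := by
  obtain ⟨x, hx⟩ := List.getLast?_eq_some_iff.1 h
  exact ⟨x, hx⟩

theorem eq_cons_of_head? {w : List (Fin 2)} {c : Fin 2} (h : w.head? = some c) :
    ∃ x, w = c :: x := by
  obtain ⟨x, hx⟩ := List.head?_eq_some_iff.1 h
  exact ⟨x, hx⟩

/-- A product of pairs of positive words is tame or conjugate to an alternating product of pairs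
of non-empty words, obtained by merging at empty words and cancelling common letters. -/
theorem isTame_or_exists_alternating (l : List (List (Fin 2) × List (Fin 2))) :
    IsTame (pairVal posVal l) ∨ ∃ l', l'.length ≤ l.length ∧ pairSize l' ≤ pairSize l ∧
      (∀ p ∈ l', p.1 ≠ [] ∧ p.2 ≠ []) ∧ Alternating List.head? List.getLast? l' ∧
      IsConj (pairVal posVal l) (pairVal posVal l') := by
  induction hn : l.length + pairSize l using Nat.strong_induction_on generalizing l with
  | _ n ih =>
  have hrec : ∀ l', l'.length ≤ l.length → pairSize l' ≤ pairSize l →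
      l'.length + pairSize l' < n → IsConj (pairVal posVal l) (pairVal posVal l') →
      IsTame (pairVal posVal l) ∨ ∃ l', l'.length ≤ l.length ∧ pairSize l' ≤ pairSize l ∧
        (∀ p ∈ l', p.1 ≠ [] ∧ p.2 ≠ []) ∧ Alternating List.head? List.getLast? l' ∧
        IsConj (pairVal posVal l) (pairVal posVal l') := by
    intro l' h1 h2 h3 h4
    rcases ih _ h3 l' rfl with h | ⟨m, h5, h6, h7, h8, h9⟩
    · exact Or.inl (h.of_isConj h4)
    · exact Or.inr ⟨m, h5.trans h1, h6.trans h2, h7, h8, h4.trans h9⟩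
  by_cases hempty : ∃ p ∈ l, p.1 = [] ∨ p.2 = []
  · rcases isTame_or_exists_shorter hempty with h | ⟨l', h1, h2, h3⟩
    · exact Or.inl h
    · exact hrec l' h1.le h2.le (by omega) h3
  have hne : ∀ p ∈ l, p.1 ≠ [] ∧ p.2 ≠ [] := by
    intro p hp
    exact ⟨fun h => hempty ⟨p, hp, Or.inl h⟩, fun h => hempty ⟨p, hp, Or.inr h⟩⟩
  by_cases hlast : ∃ p ∈ l, p.1.getLast? = p.2.getLast?
  · obtain ⟨⟨x, y⟩, hp, hxy⟩ := hlast
    obtain ⟨m, hm⟩ := exists_isRotated_cons_of_mem hp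
    obtain ⟨c, hc⟩ : ∃ c, x.getLast? = some c :=
      ⟨_, List.getLast?_eq_some_getLast (hne _ hp).1⟩
    obtain ⟨x', rfl⟩ := eq_concat_of_getLast? hc
    obtain ⟨y', rfl⟩ := eq_concat_of_getLast? (hxy ▸ hc)
    have hsize := pairSize_rotate hm
    rw [pairSize_cons] at hsize
    have hlen := hm.perm.length_eq
    simp only [List.length_append, List.length_cons, List.length_nil] at hsize hlen
    refine hrec ((x', y') :: m) (by simp [hlen]) ?_ ?_ ?_
    · rw [hsize, pairSize_cons]; dsimp only; omega
    · rw [pairSize_cons]; simp only [List.length_cons]; omega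
    · refine (isConj_pairVal_rotate hm).trans ?_
      convert IsConj.refl _ using 1
      simp only [pairVal_cons, posVal_append]
      group
  by_cases hchain : Cycle.Chain (fun p q => p.2.head? ≠ q.1.head?)
      (l : Cycle (List (Fin 2) × List (Fin 2)))
  · exact Or.inr ⟨l, le_rfl, le_rfl, hne, ⟨fun p hp h => hlast ⟨p, hp, h⟩, hchain⟩, IsConj.refl _⟩
  rcases exists_isRotated_of_not_chain hchain with ⟨⟨x, y⟩, ⟨z, w⟩, m, hm, hyz⟩ | ⟨⟨x, y⟩, rfl, hxy⟩
  · simp only [not_not] at hyz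
    obtain ⟨c, hc⟩ : ∃ c, y.head? = some c := by
      rw [← Option.isSome_iff_exists, List.isSome_head?]
      simpa using (hne (x, y) (hm.mem_iff.2 (by simp))).2
    obtain ⟨y', rfl⟩ := eq_cons_of_head? hc
    obtain ⟨z', rfl⟩ := eq_cons_of_head? (hyz ▸ hc)
    have hsize := pairSize_rotate hm
    rw [pairSize_cons, pairSize_cons] at hsize
    have hlen := hm.perm.length_eq
    simp only [List.length_cons] at hsize hlen
    refine hrec ((x, y') :: (z', w) :: m) (by simp [hlen]) ?_ ?_ ?_
    · rw [hsize, pairSize_cons, pairSize_cons]; dsimp only; omega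
    · rw [pairSize_cons, pairSize_cons]; simp only [List.length_cons]; omega
    · refine (isConj_pairVal_rotate hm).trans ?_
      convert IsConj.refl _ using 1
      simp only [pairVal_cons, posVal_cons]
      group
  · simp only [not_not] at hxy
    obtain ⟨c, hc⟩ : ∃ c, y.head? = some c := by
      rw [← Option.isSome_iff_exists, List.isSome_head?]
      simpa using (hne (x, y) (by simp)).2
    obtain ⟨y', rfl⟩ := eq_cons_of_head? hc
    obtain ⟨x', rfl⟩ := eq_cons_of_head? (hxy ▸ hc)
    refine hrec [(x', y')] (by simp) ?_ ?_ ?_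
    · rw [pairSize_cons, pairSize_cons]; simp only [List.length_cons]; omega
    · rw [← hn, pairSize_cons, pairSize_cons]; simp only [List.length_cons]; omega
    · refine isConj_iff.2 ⟨(FreeGroup.of c)⁻¹, ?_⟩
      simp only [pairVal_cons, posVal_cons, pairVal_nil]
      group

/-- Up to conjugacy, a twist acts on a product of pairs of non-empty positive words by trimming
each word. -/
theorem isConj_twist_pairVal (c : Fin 2) {l : List (List (Fin 2) × List (Fin 2))}
    (hne : ∀ p ∈ l, p.1 ≠ [] ∧ p.2 ≠ []) :
    IsConj (twist c (pairVal posVal l))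
      (pairVal posVal (l.map (Prod.map (trim c) (trim c)))) := by
  refine isConj_iff.2 ⟨(FreeGroup.of c)⁻¹, ?_⟩
  induction l with
  | nil => simp
  | cons p l ih =>
    have ih' := ih fun q hq => hne q (List.mem_cons_of_mem _ hq)
    have hp := hne p (by simp)
    rw [List.map_cons, pairVal_cons, pairVal_cons, ← ih', Prod.map_fst, Prod.map_snd,
      posVal_trim c hp.1, posVal_trim c hp.2]
    simp only [map_mul, map_inv]
    group

theorem alternating_map_trim {c : Fin 2} {l : List (List (Fin 2) × List (Fin 2))}
    (hl : Alternating List.head? List.getLast? l)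
    (hne : ∀ p ∈ l, trim c p.1 ≠ [] ∧ trim c p.2 ≠ []) :
    Alternating List.head? List.getLast? (l.map (Prod.map (trim c) (trim c))) := by
  obtain ⟨l, rfl⟩ := exists_map_subtype (P := fun w => trim c w ≠ []) hne
  rw [alternating_map, alternating_map]
  rw [alternating_map] at hl
  have h1 : ∀ w : {w // trim c w ≠ []}, (trim c w.1).head? = w.1.head? :=
    fun w => head?_trim w.2
  have h2 : ∀ w : {w // trim c w ≠ []}, (trim c w.1).getLast? = w.1.getLast? :=
    fun w => getLast?_trim w.2
  simpa only [h1, h2] using hl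

theorem pairSize_map_trim_le (c : Fin 2) (l : List (List (Fin 2) × List (Fin 2))) :
    pairSize (l.map (Prod.map (trim c) (trim c))) ≤ 2 * pairSize l := by
  induction l with
  | nil => simp [pairSize]
  | cons p l ih =>
    rw [List.map_cons, pairSize_cons, pairSize_cons, Prod.map_fst, Prod.map_snd]
    have h1 := length_trim_le c p.1
    have h2 := length_trim_le c p.2
    omega

theorem pairPureSize_le (l : List (List (Fin 2) × List (Fin 2))) :
    pairPureSize l ≤ pairSize l :=
  List.sum_le_sum fun p _ => add_le_add (pureSize_le p.1) (pureSize_le p.2)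

/-- A twist makes the words that are not mixed shorter in total, unless all of them consist of
one and the same letter, the one not fixed by the twist. -/
theorem pairPureSize_map_trim_lt {c : Fin 2} {l : List (List (Fin 2) × List (Fin 2))}
    (hne : ∀ p ∈ l, p.1 ≠ [] ∧ p.2 ≠ [])
    (hc : ¬ ∀ p ∈ l, (Mixed p.1 ∨ p.1 = [other c]) ∧ (Mixed p.2 ∨ p.2 = [other c])) :
    pairPureSize (l.map (Prod.map (trim c) (trim c))) < pairPureSize l := by
  push Not at hc
  obtain ⟨p, hp, hp'⟩ := hc
  unfold pairPureSize
  rw [List.map_map]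
  refine List.sum_lt_sum _ _ (fun q hq => ?_) ⟨p, hp, ?_⟩
  · exact add_le_add (pureSize_trim_le (hne q hq).1) (pureSize_trim_le (hne q hq).2)
  · by_cases h1 : Mixed p.1 ∨ p.1 = [other c]
    · have h2 := hp' h1
      exact add_lt_add_of_le_of_lt (pureSize_trim_le (hne p hp).1)
        (pureSize_trim_lt (hne p hp).2 h2.1 h2.2)
    · push Not at h1
      exact add_lt_add_of_lt_of_le (pureSize_trim_lt (hne p hp).1 h1.1 h1.2)
        (pureSize_trim_le (hne p hp).2)

/-- A bound for the number of twists after which a product of `t` pairs of positive words of total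
length at most `n` is tame. -/
def tameBound : ℕ → ℕ → ℕ
  | 0, _ => 0
  | t + 1, n => n + tameBound t (2 ^ n * n)

/-- Each twist either lowers the number of pairs or shortens the words that are not mixed, until
the element is tame. -/
theorem tameWithin_pairVal (t n : ℕ) (l : List (List (Fin 2) × List (Fin 2)))
    (ht : l.length ≤ t) (hn : pairSize l ≤ n) :
    TameWithin (tameBound t n) (pairVal posVal l) := by
  induction t generalizing n l with
  | zero =>
    obtain rfl : l = [] := List.length_eq_zero_iff.1 (by omega)
    exact isTame_posVal []
  | succ t ih =>
    -- `k` bounds the total length of the words that are not mixed, which every twist lowers; a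
    -- twist at most doubles the total length of all words, so `2 ^ k * pairSize l` does not grow
    have key : ∀ (k : ℕ) (l : List (List (Fin 2) × List (Fin 2))), l.length ≤ t + 1 →
        (∀ p ∈ l, p.1 ≠ [] ∧ p.2 ≠ []) → Alternating List.head? List.getLast? l →
        pairPureSize l ≤ k → 2 ^ k * pairSize l ≤ 2 ^ n * n →
        TameWithin (k + tameBound t (2 ^ n * n)) (pairVal posVal l) := by
      intro k
      induction k with
      | zero =>
        intro l _ hne hl hk _
        refine (isTame_pairVal_posVal (e := 0) hl ?_).tameWithin _
        by_contra hcon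
        have := pairPureSize_map_trim_lt (c := other 0) hne (by rwa [other_other])
        omega
      | succ k ihk =>
        intro l hlen hne hl hk hsize
        rw [Nat.add_right_comm]
        by_cases htame : IsTame (pairVal posVal l)
        · exact Or.inl htame
        refine Or.inr fun c => TameWithin.of_isConj ?_ (isConj_twist_pairVal c hne)
        have hlt := pairPureSize_map_trim_lt (c := c) hne fun h =>
          htame (isTame_pairVal_posVal hl h)
        have hsize2 := pairSize_map_trim_le c l
        have hlen2 : (l.map (Prod.map (trim c) (trim c))).length = l.length := by simp
        generalize hl' : l.map (Prod.map (trim c) (trim c)) = l' at *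
        have hpow : 2 ^ k * pairSize l' ≤ 2 ^ n * n := by
          refine le_trans (Nat.mul_le_mul_left _ hsize2) (le_trans (le_of_eq ?_) hsize)
          ring
        by_cases hempty : ∃ p ∈ l', p.1 = [] ∨ p.2 = []
        · rcases isTame_or_exists_shorter hempty with h | ⟨m, h1, h2, h3⟩
          · exact h.tameWithin _
          · refine TameWithin.of_isConj (TameWithin.mono (ih (2 ^ n * n) m (by omega) ?_)
              (Nat.le_add_left _ _)) h3
            rw [h2]
            exact le_trans (Nat.le_mul_of_pos_left _ (by positivity)) hpow
        · have hne' : ∀ p ∈ l', p.1 ≠ [] ∧ p.2 ≠ [] := fun p hp =>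
            ⟨fun h => hempty ⟨p, hp, Or.inl h⟩, fun h => hempty ⟨p, hp, Or.inr h⟩⟩
          refine ihk l' (by omega) hne' ?_ (by omega) hpow
          rw [← hl']
          refine alternating_map_trim hl fun p hp => ?_
          exact hne' (trim c p.1, trim c p.2) (by
            rw [← hl']; exact List.mem_map.2 ⟨p, hp, rfl⟩)
    rcases isTame_or_exists_alternating l with h | ⟨l', h1, h2, h3, h4, h5⟩
    · exact h.tameWithin _
    · refine TameWithin.of_isConj (key n l' (h1.trans ht) h3 h4
        ((pairPureSize_le l').trans (h2.trans hn)) ?_) h5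
      exact Nat.mul_le_mul_left _ (h2.trans hn)

/-- Every element becomes tame after boundedly many twists: a word is a product of pairs in which
one member is a letter and the other one is empty. -/
theorem tameWithin_mk (w : Word2) : TameWithin (tameBound w.length w.length) (FreeGroup.mk w) := by
  have h : ∃ l : List (List (Fin 2) × List (Fin 2)), l.length = w.length ∧
      pairSize l = w.length ∧ pairVal posVal l = FreeGroup.mk w := by
    induction w with
    | nil => exact ⟨[], rfl, rfl, rfl⟩
    | cons x w ih =>
      obtain ⟨l, h1, h2, h3⟩ := ih
      have hmk : FreeGroup.mk (x :: w) = FreeGroup.mk [x] * FreeGroup.mk w := by simp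
      rcases x with ⟨i, _ | _⟩
      · refine ⟨([], [i]) :: l, by simp [h1], by simp [pairSize_cons, h2, add_comm], ?_⟩
        rw [hmk, pairVal_cons, h3]
        simp [posVal, posWord, FreeGroup.invRev]
      · refine ⟨([i], []) :: l, by simp [h1], by simp [pairSize_cons, h2, add_comm], ?_⟩
        rw [hmk, pairVal_cons, h3]
        simp [posVal, posWord]
  obtain ⟨l, h1, h2, h3⟩ := h
  rw [← h3]
  exact tameWithin_pairVal _ _ l h1.le h2.le

/-! ### Cancellation in free groups -/

section Cancellation

variable {α : Type*} [DecidableEq α]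

/-- The length of the longest common prefix of two lists. -/
def lcp {β : Type*} [DecidableEq β] : List β → List β → ℕ
  | a :: p, b :: q => if a = b then lcp p q + 1 else 0
  | _, _ => 0

section Lcp

variable {β : Type*} [DecidableEq β]

@[simp] theorem lcp_nil_left (q : List β) : lcp [] q = 0 := by simp [lcp]

@[simp] theorem lcp_nil_right (p : List β) : lcp p [] = 0 := by cases p <;> simp [lcp]

theorem lcp_self (p : List β) : lcp p p = p.length := by
  induction p with
  | nil => rfl
  | cons a p ih => simp [lcp, ih]

theorem lcp_comm (p q : List β) : lcp p q = lcp q p := by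
  induction p generalizing q with
  | nil => simp
  | cons a p ih =>
    cases q with
    | nil => simp
    | cons b q => simp only [lcp, ih q, eq_comm]

theorem min_lcp_le (p q r : List β) : min (lcp p q) (lcp q r) ≤ lcp p r := by
  induction p generalizing q r with
  | nil => simp
  | cons a p ih =>
    cases q with
    | nil => simp
    | cons b q =>
      cases r with
      | nil => simp
      | cons c r =>
        simp only [lcp]
        have := ih q r
        by_cases h1 : a = b <;> by_cases h2 : b = c <;> simp_all

theorem take_lcp (p q : List β) : p.take (lcp p q) = q.take (lcp p q) := by
  induction p generalizing q with
  | nil => simp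
  | cons a p ih =>
    cases q with
    | nil => simp
    | cons b q =>
      simp only [lcp]
      split_ifs with h
      · simp [h, ih q]
      · simp

end Lcp

/-- The number of letters of `g` that cancel in the product `g * h`. -/
def cancel (g h : FreeGroup α) : ℕ := lcp g⁻¹.toWord h.toWord

theorem length_reduce_invRev_append {p q : List (α × Bool)} (hp : FreeGroup.IsReduced p)
    (hq : FreeGroup.IsReduced q) :
    (FreeGroup.reduce (FreeGroup.invRev p ++ q)).length + 2 * lcp p q = p.length + q.length := by
  have hinv : ∀ {p : List (α × Bool)}, FreeGroup.IsReduced p →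
      FreeGroup.IsReduced (FreeGroup.invRev p) := fun hp => by
    rw [FreeGroup.isReduced_iff_reduce_eq, FreeGroup.reduce_invRev, hp.reduce_eq]
  induction p generalizing q with
  | nil => simp [hq.reduce_eq]
  | cons a p ih =>
    cases q with
    | nil => simp [(hinv hp).reduce_eq]
    | cons b q =>
      by_cases hab : a = b
      · subst hab
        have h := ih (q := q) (hp.infix ⟨[a], [], by simp⟩) (hq.infix ⟨[a], [], by simp⟩)
        have hmk : FreeGroup.mk (FreeGroup.invRev (a :: p) ++ a :: q) =
            FreeGroup.mk (FreeGroup.invRev p ++ q) := by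
          rw [← FreeGroup.mul_mk, ← FreeGroup.mul_mk, ← FreeGroup.inv_mk, ← FreeGroup.inv_mk,
            ← List.singleton_append (l := p), ← List.singleton_append (l := q),
            ← FreeGroup.mul_mk, ← FreeGroup.mul_mk]
          group
        rw [FreeGroup.reduce.sound hmk]
        simp only [lcp, if_true, List.length_cons]
        omega
      · have hred : FreeGroup.IsReduced (FreeGroup.invRev (a :: p) ++ b :: q) := by
          rw [FreeGroup.IsReduced, List.isChain_append]
          refine ⟨hinv hp, hq, ?_⟩
          intro x hx y hy hxy
          have hx' : x = (a.1, !a.2) := by simpa [FreeGroup.invRev, eq_comm] using hx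
          have hy' : y = b := by simpa [eq_comm] using hy
          subst hx' hy'
          by_contra hne
          exact hab (Prod.ext hxy (by simpa using hne))
        rw [hred.reduce_eq]
        simp [lcp, hab]

theorem norm_mul_add_cancel (g h : FreeGroup α) :
    (g * h).norm + 2 * cancel g h = g.norm + h.norm := by
  have := length_reduce_invRev_append (FreeGroup.isReduced_toWord (x := g⁻¹))
    (FreeGroup.isReduced_toWord (x := h))
  rw [← FreeGroup.toWord_inv, inv_inv, ← FreeGroup.toWord_mul] at this
  rw [FreeGroup.norm, cancel, this, ← FreeGroup.norm, FreeGroup.norm_inv_eq, ← FreeGroup.norm]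

/-- Less than half of a non-trivial element cancels when it is squared. -/
theorem norm_lt_norm_mul_self {g : FreeGroup α} (hg : g ≠ 1) : g.norm < (g * g).norm := by
  have h := FreeGroup.reduceCyclically.reduce_flatten_replicate
    (FreeGroup.isReduced_toWord (x := g)) 2
  have h1 := FreeGroup.reduceCyclically.conj_conjugator_reduceCyclically g.toWord
  have h2 : (g * g).toWord = FreeGroup.reduce (List.replicate 2 g.toWord).flatten := by
    rw [FreeGroup.toWord_mul]; simp [List.replicate]
  have h3 : FreeGroup.reduceCyclically g.toWord ≠ [] := by
    intro h0
    rw [h0, List.append_nil] at h1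
    refine hg ?_
    rw [← FreeGroup.mk_toWord (x := g), ← h1, ← FreeGroup.mul_mk, ← FreeGroup.inv_mk]
    group
  have h4 := List.length_pos_iff.2 h3
  rw [FreeGroup.norm, FreeGroup.norm, h2, h]
  conv_lhs => rw [← h1]
  simp [List.replicate]
  omega

/-- The letters of `h` that do not cancel in `g * h` are a common suffix of `g * h` and `h`. -/
theorem lcp_inv_mul_inv (g h : FreeGroup α) :
    lcp (g * h)⁻¹.toWord h⁻¹.toWord + cancel g h = h.norm := by
  have h1 := norm_mul_add_cancel g h
  have h2 := norm_mul_add_cancel (g * h) h⁻¹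
  rw [mul_inv_cancel_right, FreeGroup.norm_inv_eq] at h2
  rw [cancel] at h2
  omega

end Cancellation

/-! ### The automorphisms of the free group of rank two -/

/-- The inverse of a letter. -/
def invLetter (x : Fin 2 × Bool) : Fin 2 × Bool := (x.1, !x.2)

theorem mk_invLetter (x : Fin 2 × Bool) :
    FreeGroup.mk [invLetter x] = (FreeGroup.mk [x] : F2)⁻¹ := by
  simp [FreeGroup.inv_mk, FreeGroup.invRev, invLetter]

/-- If no letter is cancelled completely from its two sides in the product of the images of three
consecutive letters of a reduced word, then an automorphism does not shorten reduced words. -/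
theorem length_le_norm_of_cancel_lt (φ : MulAut F2)
    (h : ∀ l k j : Fin 2 × Bool, k ≠ invLetter l → j ≠ invLetter k →
      cancel (φ (FreeGroup.mk [l])) (φ (FreeGroup.mk [k])) +
        cancel (φ (FreeGroup.mk [k])) (φ (FreeGroup.mk [j])) < (φ (FreeGroup.mk [k])).norm)
    {w : Word2} (hw : FreeGroup.IsReduced w) : w.length ≤ (φ (FreeGroup.mk w)).norm := by
  have hself : ∀ l : Fin 2 × Bool, l ≠ invLetter l := by decide
  have hne : ∀ {l k : Fin 2 × Bool}, (l.1 = k.1 → l.2 = k.2) → k ≠ invLetter l := by decide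
  -- The image of `w l` ends with more letters of the image of `l` than any next letter can cancel.
  have key : ∀ (w : Word2) (l : Fin 2 × Bool), FreeGroup.IsReduced (w ++ [l]) →
      (∀ k, k ≠ invLetter l → cancel (φ (FreeGroup.mk [l])) (φ (FreeGroup.mk [k])) <
        lcp (φ (FreeGroup.mk (w ++ [l])))⁻¹.toWord (φ (FreeGroup.mk [l]))⁻¹.toWord) ∧
      w.length + lcp (φ (FreeGroup.mk (w ++ [l])))⁻¹.toWord (φ (FreeGroup.mk [l]))⁻¹.toWord ≤
        (φ (FreeGroup.mk (w ++ [l]))).norm := by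
    intro w
    induction w using List.reverseRecOn with
    | nil =>
      intro l _
      rw [List.nil_append, lcp_self, ← FreeGroup.norm, FreeGroup.norm_inv_eq]
      refine ⟨fun k hk => ?_, by simp⟩
      have := h l l k (hself l) hk
      omega
    | append_singleton w l ih =>
      intro k hk
      have hwl : FreeGroup.IsReduced (w ++ [l]) := hk.infix ⟨[], [k], by simp⟩
      obtain ⟨ih1, ih2⟩ := ih l hwl
      have hkl : k ≠ invLetter l := by
        rw [List.append_assoc, List.singleton_append] at hk
        exact hne (List.isChain_append_cons_cons.1 hk).2.1
      have hmk : φ (FreeGroup.mk (w ++ [l] ++ [k])) =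
          φ (FreeGroup.mk (w ++ [l])) * φ (FreeGroup.mk [k]) := by
        rw [← FreeGroup.mul_mk, map_mul]
      generalize φ (FreeGroup.mk (w ++ [l])) = g at *
      rw [hmk]
      have hc : cancel g (φ (FreeGroup.mk [k])) ≤
          cancel (φ (FreeGroup.mk [l])) (φ (FreeGroup.mk [k])) := by
        have h1 := min_lcp_le (φ (FreeGroup.mk [l]))⁻¹.toWord g⁻¹.toWord
          (φ (FreeGroup.mk [k])).toWord
        have h2 := ih1 k hkl
        rw [lcp_comm] at h1
        change min _ (cancel g _) ≤ cancel _ _ at h1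
        omega
      have h3 := lcp_inv_mul_inv g (φ (FreeGroup.mk [k]))
      have h4 := norm_mul_add_cancel g (φ (FreeGroup.mk [k]))
      have h5 := ih1 k hkl
      refine ⟨fun j hj => ?_, ?_⟩
      · have := h l k j hkl hj
        omega
      · simp only [List.length_append, List.length_cons, List.length_nil]
        omega
  rcases List.eq_nil_or_concat w with rfl | ⟨w, l, rfl⟩
  · simp
  · rw [List.concat_eq_append] at hw ⊢
    obtain ⟨h1, h2⟩ := key w l hw
    have := h1 l (hself l)
    simp only [List.length_append, List.length_cons, List.length_nil]
    omega

/-- The total length of the images of the two letters. -/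
def autSize (φ : MulAut F2) : ℕ :=
  (φ (FreeGroup.of 0)).norm + (φ (FreeGroup.of 1)).norm

theorem autSize_eq (φ : MulAut F2) (c : Fin 2) :
    autSize φ = (φ (FreeGroup.of c)).norm + (φ (FreeGroup.of (other c))).norm := by
  fin_cases c
  · rfl
  · exact add_comm _ _

theorem twist_inv_of_other (c : Fin 2) : (twist c)⁻¹ (FreeGroup.of (other c)) =
    (FreeGroup.of c)⁻¹ * FreeGroup.of (other c) := by
  rw [MulAut.inv_apply, MulEquiv.symm_apply_eq, map_mul, map_inv, twist_of, twist_of_other]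
  group

theorem twist_inv_of (c : Fin 2) : (twist c)⁻¹ (FreeGroup.of c) = FreeGroup.of c := by
  rw [MulAut.inv_apply, MulEquiv.symm_apply_eq, twist_of]

/-- No twist, inverse twist or composition of one of these with an inner automorphism makes the
images of the letters shorter in total. -/
def IsShort (φ : MulAut F2) : Prop :=
  ∀ (g : F2) (c : Fin 2), autSize φ ≤ autSize (MulAut.conj g * φ * twist c) ∧
    autSize φ ≤ autSize (MulAut.conj g * φ * (twist c)⁻¹)

theorem norm_conj_inv (g x : F2) : (g * x⁻¹ * g⁻¹).norm = (g * x * g⁻¹).norm := by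
  rw [← FreeGroup.norm_inv_eq]
  congr 1
  group

section IsShort

variable {φ : MulAut F2}

/-- For a short automorphism, replacing the image `x` of one letter by `x y`, where `y` is the image
of the other letter, and conjugating by `g` does not make the images shorter in total. -/
theorem IsShort.norm_le (h : IsShort φ) (l k : Fin 2 × Bool) (hlk : l.1 ≠ k.1) (g : F2) :
    (φ (FreeGroup.mk [l])).norm + (φ (FreeGroup.mk [k])).norm ≤
      (g * φ (FreeGroup.mk [k]) * g⁻¹).norm +
        (g * (φ (FreeGroup.mk [l]) * φ (FreeGroup.mk [k])) * g⁻¹).norm := by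
  obtain ⟨c, b⟩ := l
  obtain ⟨d, b'⟩ := k
  obtain rfl : c = other d := eq_other_of_ne hlk
  have hpos : ∀ i : Fin 2, (FreeGroup.mk [(i, true)] : F2) = FreeGroup.of i := fun i => rfl
  have hneg : ∀ i : Fin 2, (FreeGroup.mk [(i, false)] : F2) = (FreeGroup.of i)⁻¹ := fun i => by
    simp [FreeGroup.of, FreeGroup.inv_mk, FreeGroup.invRev]
  have hsize := autSize_eq φ d
  have key : ∀ g, autSize φ ≤ (g * φ (FreeGroup.of d) * g⁻¹).norm +
        (g * (φ (FreeGroup.of d) * φ (FreeGroup.of (other d))) * g⁻¹).norm ∧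
      autSize φ ≤ (g * φ (FreeGroup.of d) * g⁻¹).norm +
        (g * ((φ (FreeGroup.of d))⁻¹ * φ (FreeGroup.of (other d))) * g⁻¹).norm := by
    intro g
    have h1 := h g d
    rw [autSize_eq (MulAut.conj g * φ * twist d) d,
      autSize_eq (MulAut.conj g * φ * (twist d)⁻¹) d] at h1
    simp only [MulAut.mul_apply, twist_of, twist_of_other, twist_inv_of, twist_inv_of_other,
      map_mul φ, map_inv φ, MulAut.conj_apply] at h1
    exact h1
  cases b <;> cases b' <;> simp only [hpos, hneg, map_inv, FreeGroup.norm_inv_eq]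
  all_goals
    generalize φ (FreeGroup.of d) = y at *
    generalize φ (FreeGroup.of (other d)) = x at *
  · have h1 := (key g).1
    rw [← norm_conj_inv g y, ← norm_conj_inv g (y * x)] at h1
    rw [mul_inv_rev] at h1
    omega
  · have h1 := (key g).2
    rw [← norm_conj_inv g (y⁻¹ * x), mul_inv_rev, inv_inv] at h1
    omega
  · have h1 := (key (g * y)).2
    rw [show g * y * y * (g * y)⁻¹ = g * y * g⁻¹ by group,
      show g * y * (y⁻¹ * x) * (g * y)⁻¹ = g * (x * y⁻¹) * g⁻¹ by group] at h1
    rw [norm_conj_inv]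
    omega
  · have h1 := (key (g * y⁻¹)).1
    rw [show g * y⁻¹ * y * (g * y⁻¹)⁻¹ = g * y * g⁻¹ by group,
      show g * y⁻¹ * (y * x) * (g * y⁻¹)⁻¹ = g * (x * y) * g⁻¹ by group] at h1
    omega

theorem map_letter_ne_one (φ : MulAut F2) (l : Fin 2 × Bool) : φ (FreeGroup.mk [l]) ≠ 1 := by
  rw [Ne, EmbeddingLike.map_eq_one_iff, ← FreeGroup.toWord_eq_nil_iff]
  simp

/-- For a short automorphism, at most half of the image of a letter cancels on either side. -/
theorem IsShort.two_mul_cancel_le (h : IsShort φ) (l k : Fin 2 × Bool) (hlk : l.1 ≠ k.1) :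
    2 * cancel (φ (FreeGroup.mk [l])) (φ (FreeGroup.mk [k])) ≤ (φ (FreeGroup.mk [l])).norm ∧
      2 * cancel (φ (FreeGroup.mk [l])) (φ (FreeGroup.mk [k])) ≤
        (φ (FreeGroup.mk [k])).norm := by
  have h0 := norm_mul_add_cancel (φ (FreeGroup.mk [l])) (φ (FreeGroup.mk [k]))
  have h1 := h.norm_le l k hlk 1
  have h2 := h.norm_le (invLetter k) (invLetter l) hlk.symm 1
  simp only [one_mul, inv_one, mul_one, mk_invLetter, map_inv, ← mul_inv_rev,
    FreeGroup.norm_inv_eq] at h1 h2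
  omega

/-- If exactly half of the image of a letter `k` cancelled on either side in the image of a word
`l k l`, conjugating by one half would shorten the images of the letters. -/
theorem IsShort.cancel_add_cancel_lt (h : IsShort φ) (l k : Fin 2 × Bool) (hlk : l.1 ≠ k.1) :
    cancel (φ (FreeGroup.mk [l])) (φ (FreeGroup.mk [k])) +
      cancel (φ (FreeGroup.mk [k])) (φ (FreeGroup.mk [l])) < (φ (FreeGroup.mk [k])).norm := by
  have h1 := h.two_mul_cancel_le l k hlk
  have h2 := h.two_mul_cancel_le k l hlk.symm
  by_contra hcon
  have hshort := h.norm_le l k hlk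
  have hk1 := map_letter_ne_one φ k
  generalize φ (FreeGroup.mk [l]) = x at *
  generalize φ (FreeGroup.mk [k]) = y at *
  obtain ⟨n, hn⟩ : ∃ n, y.norm = 2 * n := ⟨cancel x y, by omega⟩
  have hc1 : lcp x⁻¹.toWord y.toWord = n := by
    change cancel x y = n; omega
  have hc2 : lcp y⁻¹.toWord x.toWord = n := by
    change cancel y x = n; omega
  have t1 := take_lcp x⁻¹.toWord y.toWord
  have t2 := take_lcp y⁻¹.toWord x.toWord
  rw [hc1] at t1
  rw [hc2] at t2
  rw [FreeGroup.toWord_inv] at t1 t2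
  have hylen : y.toWord.length = 2 * n := hn
  have hxlen : 2 * n ≤ x.toWord.length := by
    change 2 * n ≤ x.norm; omega
  -- `y = s * t` with both halves of length `n`; `x` starts with `t⁻¹` and ends with `s⁻¹`
  set s := y.toWord.take n with hs
  set t := y.toWord.drop n with ht
  have hst : y.toWord = s ++ t := (List.take_append_drop n _).symm
  have hsn : s.length = n := by rw [hs, List.length_take]; omega
  have htn : t.length = n := by rw [ht, List.length_drop]; omega
  have hinv : FreeGroup.invRev y.toWord = FreeGroup.invRev t ++ FreeGroup.invRev s := by
    rw [hst, FreeGroup.invRev_append]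
  rw [hinv, List.take_left' (by simp [htn])] at t2
  obtain ⟨m, hm⟩ : ∃ m, x.toWord = FreeGroup.invRev t ++ m ++ FreeGroup.invRev s := by
    have e1 : x.toWord = FreeGroup.invRev t ++ x.toWord.drop n := by
      rw [t2, List.take_append_drop]
    have e2 : FreeGroup.invRev x.toWord = s ++ (FreeGroup.invRev x.toWord).drop n := by
      rw [← t1, List.take_append_drop]
    have e3 : x.toWord = FreeGroup.invRev ((FreeGroup.invRev x.toWord).drop n) ++
        FreeGroup.invRev s := by
      have := congrArg FreeGroup.invRev e2
      rw [FreeGroup.invRev_invRev] at this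
      exact this.trans FreeGroup.invRev_append
    refine ⟨(FreeGroup.invRev ((FreeGroup.invRev x.toWord).drop n)).drop n, ?_⟩
    have hlen : n ≤ (FreeGroup.invRev ((FreeGroup.invRev x.toWord).drop n)).length := by
      simp; omega
    have e4 : x.toWord.drop n =
        (FreeGroup.invRev ((FreeGroup.invRev x.toWord).drop n)).drop n ++
          FreeGroup.invRev s := by
      conv_lhs => rw [e3]
      rw [List.drop_append_of_le_length hlen]
    rw [List.append_assoc, ← e4]
    exact e1
  have hx : x = (FreeGroup.mk t)⁻¹ * FreeGroup.mk m * (FreeGroup.mk s)⁻¹ := by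
    rw [← FreeGroup.mk_toWord (x := x), hm]
    simp [FreeGroup.inv_mk]
  have hy : y = FreeGroup.mk s * FreeGroup.mk t := by
    rw [← FreeGroup.mk_toWord (x := y), hst]
    simp
  have hfin := hshort (FreeGroup.mk t)
  have e1 : FreeGroup.mk t * y * (FreeGroup.mk t)⁻¹ = FreeGroup.mk (t ++ s) := by
    rw [hy, ← FreeGroup.mul_mk]; group
  have e2 : FreeGroup.mk t * (x * y) * (FreeGroup.mk t)⁻¹ = FreeGroup.mk m := by
    rw [hy, hx]; group
  rw [e1, e2] at hfin
  have n1 := FreeGroup.norm_mk_le (L₁ := t ++ s)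
  have n2 := FreeGroup.norm_mk_le (L₁ := m)
  have n3 := congrArg List.length hm
  simp only [List.length_append, FreeGroup.invRev_length] at n1 n3
  have n4 : x.norm = x.toWord.length := rfl
  have n5 : y.norm = 0 := by omega
  exact hk1 (FreeGroup.norm_eq_zero.1 n5)

/-- A short automorphism does not shorten any element. -/
theorem IsShort.length_le_norm (h : IsShort φ) (g : F2) : g.norm ≤ (φ g).norm := by
  have hcases : ∀ {l k : Fin 2 × Bool}, k ≠ invLetter l → l = k ∨ l.1 ≠ k.1 := by decide
  have hcases' : ∀ {l k j : Fin 2 × Bool}, l.1 ≠ k.1 → k.1 ≠ j.1 → j = l ∨ j = invLetter l := by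
    decide
  have hself : ∀ k : Fin 2 × Bool,
      2 * cancel (φ (FreeGroup.mk [k])) (φ (FreeGroup.mk [k])) < (φ (FreeGroup.mk [k])).norm := by
    intro k
    have h1 := norm_lt_norm_mul_self (map_letter_ne_one φ k)
    have h2 := norm_mul_add_cancel (φ (FreeGroup.mk [k])) (φ (FreeGroup.mk [k]))
    omega
  have := length_le_norm_of_cancel_lt φ ?_ (FreeGroup.isReduced_toWord (x := g))
  · rwa [FreeGroup.mk_toWord] at this
  intro l k j hk hj
  have hk2 := hself k
  rcases hcases hk with rfl | hlk <;> rcases hcases hj with rfl | hkj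
  · omega
  · have := h.two_mul_cancel_le l j hkj
    omega
  · have := h.two_mul_cancel_le l k hlk
    omega
  -- In `l k l` and `l k l⁻¹` the two cancellations inside the image of `k` cannot be half of it
  -- each: the former is excluded by conjugation, and in the latter the two halves of the image of
  -- `k` would cancel against each other when it is squared.
  rcases hcases' hlk hkj with rfl | rfl
  · exact h.cancel_add_cancel_lt _ _ hlk
  · have h1 := (h.two_mul_cancel_le l k hlk).2
    have h2 := (h.two_mul_cancel_le k (invLetter l) hkj).1
    have h3 := min_lcp_le (φ (FreeGroup.mk [k]))⁻¹.toWord (φ (FreeGroup.mk [l]))⁻¹.toWord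
      (φ (FreeGroup.mk [k])).toWord
    rw [mk_invLetter, map_inv] at h2 ⊢
    change min (cancel _ (φ (FreeGroup.mk [l]))⁻¹) (cancel _ _) ≤ cancel _ _ at h3
    omega

end IsShort

/-- An automorphism permuting the letters and their inverses. -/
def IsSigned (d : MulAut F2) : Prop :=
  ∀ c, ∃ x : Fin 2 × Bool, d (FreeGroup.of c) = FreeGroup.mk [x]

theorem IsSigned.map_letter {d : MulAut F2} (hd : IsSigned d) (x : Fin 2 × Bool) :
    ∃ y : Fin 2 × Bool, d (FreeGroup.mk [x]) = FreeGroup.mk [y] := by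
  obtain ⟨i, b⟩ := x
  obtain ⟨y, hy⟩ := hd i
  cases b
  · refine ⟨invLetter y, ?_⟩
    rw [mk_invLetter, ← hy, ← map_inv]
    congr 1
  · exact ⟨y, hy⟩

theorem IsSigned.mul {d d' : MulAut F2} (hd : IsSigned d) (hd' : IsSigned d') :
    IsSigned (d * d') := by
  intro c
  obtain ⟨x, hx⟩ := hd' c
  rw [MulAut.mul_apply, hx]
  exact hd.map_letter x

theorem mk_letter_inj {x y : Fin 2 × Bool} (h : (FreeGroup.mk [x] : F2) = FreeGroup.mk [y]) :
    x = y := by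
  have := congrArg FreeGroup.toWord h
  simpa [FreeGroup.reduce_singleton] using this

theorem IsSigned.fst_ne {d : MulAut F2} {c : Fin 2} {x y : Fin 2 × Bool}
    (hx : d (FreeGroup.of c) = FreeGroup.mk [x])
    (hy : d (FreeGroup.of (other c)) = FreeGroup.mk [y]) : y.1 ≠ x.1 := by
  intro hxy
  have hcases : ∀ x y : Fin 2 × Bool, y.1 = x.1 → y = x ∨ y = invLetter x := by decide
  rcases hcases x y hxy with rfl | rfl
  · rw [← hx] at hy
    have := mk_letter_inj (x := (other c, true)) (y := (c, true)) (d.injective hy)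
    exact other_ne c (congrArg Prod.fst this)
  · rw [mk_invLetter, ← hx, ← map_inv] at hy
    have := mk_letter_inj (x := (other c, true)) (y := invLetter (c, true))
      (by rw [mk_invLetter]; exact d.injective hy)
    exact other_ne c (congrArg Prod.fst this)

theorem IsSigned.inv {d : MulAut F2} (hd : IsSigned d) : IsSigned d⁻¹ := by
  intro i
  obtain ⟨x, hx⟩ := hd 0
  obtain ⟨y, hy⟩ := hd 1
  have hne : y.1 ≠ x.1 := IsSigned.fst_ne (c := 0) hx hy
  have key : ∀ (c : Fin 2) (x : Fin 2 × Bool), d (FreeGroup.of c) = FreeGroup.mk [x] →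
      x.1 = i → ∃ z : Fin 2 × Bool, d⁻¹ (FreeGroup.of i) = FreeGroup.mk [z] := by
    rintro c ⟨j, b⟩ hx rfl
    cases b
    · refine ⟨(c, false), ?_⟩
      rw [MulAut.inv_apply, MulEquiv.symm_apply_eq,
        show (FreeGroup.mk [(c, false)] : F2) = (FreeGroup.of c)⁻¹ from mk_invLetter (c, true),
        map_inv, hx, ← mk_invLetter]
      rfl
    · refine ⟨(c, true), ?_⟩
      rw [MulAut.inv_apply, MulEquiv.symm_apply_eq]
      exact hx.symm
  by_cases h : x.1 = i
  · exact key 0 x hx h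
  · refine key 1 y hy ?_
    clear key
    revert hne h
    generalize x.1 = p
    generalize y.1 = q
    revert p q i
    decide

/-- The preimages of the letters under a short automorphism have length one, because the
automorphism does not shorten them. -/
theorem IsShort.isSigned {φ : MulAut F2} (h : IsShort φ) : IsSigned φ := by
  have : IsSigned φ⁻¹ := by
    intro c
    have h1 := h.length_le_norm (φ⁻¹ (FreeGroup.of c))
    rw [MulAut.apply_inv_self, FreeGroup.norm_of] at h1
    have h2 : (φ⁻¹ (FreeGroup.of c)).norm ≠ 0 := by
      rw [Ne, FreeGroup.norm_eq_zero]
      exact map_letter_ne_one φ⁻¹ (c, true)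
    obtain ⟨x, hx⟩ := List.length_eq_one_iff.1
      (show (φ⁻¹ (FreeGroup.of c)).toWord.length = 1 by rw [← FreeGroup.norm]; omega)
    exact ⟨x, by rw [← hx, FreeGroup.mk_toWord]⟩
  simpa using this.inv

/-! ### Signed automorphisms and a normal form for automorphisms -/

theorem mulAut_ext {φ ψ : MulAut F2} (c : Fin 2) (h : φ (FreeGroup.of c) = ψ (FreeGroup.of c))
    (h' : φ (FreeGroup.of (other c)) = ψ (FreeGroup.of (other c))) : φ = ψ := by
  have : φ.toMonoidHom = ψ.toMonoidHom := by
    ext i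
    rcases eq_or_eq_other c i with rfl | rfl
    · exact h
    · exact h'
  exact MulEquiv.ext fun x => DFunLike.congr_fun this x

theorem mul_conj (φ : MulAut F2) (g : F2) :
    φ * MulAut.conj g = MulAut.conj (φ g) * φ := by
  ext x; simp

theorem of_eq_mk (c : Fin 2) : (FreeGroup.of c : F2) = FreeGroup.mk [(c, true)] := rfl

theorem mk_false (c : Fin 2) : (FreeGroup.mk [(c, false)] : F2) = (FreeGroup.of c)⁻¹ :=
  mk_invLetter (c, true)

/-- The automorphism inverting the letter `c` and fixing the other letter. -/
def negLetter (c : Fin 2) : MulAut F2 :=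
  MonoidHom.toMulEquiv
    (FreeGroup.lift fun i => if i = c then (FreeGroup.of c)⁻¹ else FreeGroup.of i)
    (FreeGroup.lift fun i => if i = c then (FreeGroup.of c)⁻¹ else FreeGroup.of i)
    (by ext i; by_cases h : i = c <;> simp [h])
    (by ext i; by_cases h : i = c <;> simp [h])

@[simp] theorem negLetter_of (c : Fin 2) : negLetter c (FreeGroup.of c) = (FreeGroup.of c)⁻¹ := by
  simp [negLetter]

@[simp] theorem negLetter_of_other (c : Fin 2) :
    negLetter c (FreeGroup.of (other c)) = FreeGroup.of (other c) := by
  simp [negLetter, other_ne]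

/-- The automorphism exchanging the two letters. -/
def swapLetters : MulAut F2 := FreeGroup.freeGroupCongr Fin.revPerm

@[simp] theorem swapLetters_of (c : Fin 2) :
    swapLetters (FreeGroup.of c) = FreeGroup.of (other c) := rfl

theorem isSigned_one : IsSigned 1 := fun c => ⟨(c, true), rfl⟩

theorem isSigned_negLetter (c : Fin 2) : IsSigned (negLetter c) := by
  intro i
  rcases eq_or_eq_other c i with rfl | rfl
  · exact ⟨(i, false), by rw [negLetter_of, mk_false]⟩
  · exact ⟨(other c, true), by rw [negLetter_of_other, of_eq_mk]⟩

theorem isSigned_swapLetters : IsSigned swapLetters := fun c => ⟨(other c, true), swapLetters_of c⟩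

theorem twist_inv_eq (c : Fin 2) : (twist c)⁻¹ = negLetter c * twist c * negLetter c := by
  apply mulAut_ext c <;> 
    simp [MulAut.mul_apply, twist_inv_of_other, twist_inv_of, -MulAut.inv_apply, mul_assoc]

/-- An inverse twist following a twist by the other letter is replaced by a twist, up to inner and
signed automorphisms; this is how inverse twists are eliminated. -/
theorem twist_other_mul_twist_inv (c : Fin 2) : twist (other c) * (twist c)⁻¹ =
    MulAut.conj (FreeGroup.of c)⁻¹ * twist c * (negLetter c * swapLetters) := by
  have h1 : twist (other c) (FreeGroup.of c) = FreeGroup.of (other c) * FreeGroup.of c := by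
    simpa using twist_of_other (other c)
  apply mulAut_ext c
  · simp [MulAut.mul_apply, twist_inv_of, h1, -MulAut.inv_apply, mul_assoc]
  · simp [MulAut.mul_apply, twist_inv_of_other, h1, -MulAut.inv_apply, mul_assoc]

/-- A twist can be moved to the left of a signed automorphism, where it becomes a twist or an
inverse twist up to conjugation. -/
theorem IsSigned.mul_twist {d : MulAut F2} (hd : IsSigned d) (c : Fin 2) :
    ∃ (h : F2) (i : Fin 2), d * twist c = MulAut.conj h * twist i * d ∨
      d * twist c = MulAut.conj h * (twist i)⁻¹ * d := by
  obtain ⟨⟨i, b⟩, hx⟩ := hd c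
  obtain ⟨⟨j, b'⟩, hy⟩ := hd (other c)
  obtain rfl : j = other i := eq_other_of_ne (IsSigned.fst_ne hx hy)
  cases b <;> cases b' <;> simp only [mk_false, ← of_eq_mk] at hx hy
  on_goal 1 => refine ⟨(FreeGroup.of i)⁻¹, i, Or.inl ?_⟩
  on_goal 2 => refine ⟨1, i, Or.inr ?_⟩
  on_goal 3 => refine ⟨FreeGroup.of i, i, Or.inr ?_⟩
  on_goal 4 => refine ⟨1, i, Or.inl ?_⟩
  all_goals
    apply mulAut_ext c <;>
      simp only [MulAut.mul_apply, MulAut.conj_apply, twist_of, twist_of_other, hx, hy, map_mul,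
        map_inv (twist i), map_inv (twist i)⁻¹, twist_inv_of, twist_inv_of_other] <;> group

/-- An automorphism which is, up to an inner automorphism, a product of twists with a signed
automorphism on either side. -/
def InNormalForm (φ : MulAut F2) : Prop :=
  ∃ (g : F2) (d₁ : MulAut F2) (r : List (Fin 2)) (d₂ : MulAut F2), IsSigned d₁ ∧ IsSigned d₂ ∧
    φ = MulAut.conj g * d₁ * (r.map twist).prod * d₂

theorem IsSigned.inNormalForm {d : MulAut F2} (hd : IsSigned d) : InNormalForm d :=
  ⟨1, 1, [], d, isSigned_one, hd, by simp⟩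

namespace InNormalForm

variable {φ : MulAut F2}

theorem conj_mul (h : InNormalForm φ) (g : F2) : InNormalForm (MulAut.conj g * φ) := by
  obtain ⟨g', d₁, r, d₂, h₁, h₂, rfl⟩ := h
  exact ⟨g * g', d₁, r, d₂, h₁, h₂, by simp only [map_mul, mul_assoc]⟩

theorem mul_signed (h : InNormalForm φ) {d : MulAut F2} (hd : IsSigned d) :
    InNormalForm (φ * d) := by
  obtain ⟨g, d₁, r, d₂, h₁, h₂, rfl⟩ := h
  exact ⟨g, d₁, r, d₂ * d, h₁, h₂.mul hd, by simp only [mul_assoc]⟩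

theorem signed_mul_prod_mul_twist_inv {d : MulAut F2} (hd : IsSigned d) (r : List (Fin 2))
    (i : Fin 2) : InNormalForm (d * (r.map twist).prod * (twist i)⁻¹) := by
  rcases List.eq_nil_or_concat r with rfl | ⟨r, j, rfl⟩
  · refine ⟨1, d * negLetter i, [i], negLetter i, hd.mul (isSigned_negLetter i),
      isSigned_negLetter i, ?_⟩
    simp [twist_inv_eq, mul_assoc]
  · rcases eq_or_eq_other i j with rfl | rfl
    · exact ⟨1, d, r, 1, hd, isSigned_one, by simp [mul_assoc]⟩
    · have : d * ((r.concat (other i)).map twist).prod * (twist i)⁻¹ =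
          MulAut.conj ((d * (r.map twist).prod) (FreeGroup.of i)⁻¹) *
            (d * ((r ++ [i]).map twist).prod * (negLetter i * swapLetters)) := by
        simp only [List.concat_eq_append, List.map_append, List.prod_append, List.map_cons,
          List.map_nil, List.prod_singleton]
        rw [← mul_assoc d, mul_assoc (d * _), twist_other_mul_twist_inv,
          mul_assoc (MulAut.conj _), ← mul_assoc (d * _),
          mul_conj]
        simp only [mul_assoc]
      rw [this]
      exact conj_mul ⟨1, d, r ++ [i], negLetter i * swapLetters, hd,
        (isSigned_negLetter i).mul isSigned_swapLetters, by simp⟩ _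

theorem mul_twist (h : InNormalForm φ) (c : Fin 2) : InNormalForm (φ * twist c) := by
  obtain ⟨g, d₁, r, d₂, h₁, h₂, rfl⟩ := h
  obtain ⟨k, i, hk | hk⟩ := h₂.mul_twist c
  · have : MulAut.conj g * d₁ * (r.map twist).prod * d₂ * twist c =
        MulAut.conj (g * (d₁ * (r.map twist).prod) k) *
          (d₁ * ((r ++ [i]).map twist).prod * d₂) := by
      rw [map_mul, mul_assoc _ d₂, hk, ← mul_assoc, ← mul_assoc, mul_assoc _ d₁,
        mul_assoc _ (d₁ * _), mul_conj]
      simp [mul_assoc]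
    rw [this]
    exact conj_mul ⟨1, d₁, r ++ [i], d₂, h₁, h₂, by simp⟩ _
  · have : MulAut.conj g * d₁ * (r.map twist).prod * d₂ * twist c =
        MulAut.conj (g * (d₁ * (r.map twist).prod) k) *
          (d₁ * (r.map twist).prod * (twist i)⁻¹ * d₂) := by
      rw [map_mul, mul_assoc _ d₂, hk, ← mul_assoc, ← mul_assoc, mul_assoc _ d₁,
        mul_assoc _ (d₁ * _), mul_conj]
      simp [mul_assoc]
    rw [this]
    exact ((signed_mul_prod_mul_twist_inv h₁ r i).mul_signed h₂).conj_mul _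

theorem mul_twist_inv (h : InNormalForm φ) (c : Fin 2) : InNormalForm (φ * (twist c)⁻¹) := by
  rw [twist_inv_eq, ← mul_assoc, ← mul_assoc]
  exact ((h.mul_signed (isSigned_negLetter c)).mul_twist c).mul_signed (isSigned_negLetter c)

end InNormalForm

/-- Every automorphism has a normal form: as long as it is not signed, twists, their inverses and
conjugation make it smaller. -/
theorem inNormalForm (φ : MulAut F2) : InNormalForm φ := by
  induction h : autSize φ using Nat.strong_induction_on generalizing φ with
  | _ n ih =>
  subst h
  by_cases hφ : IsShort φ
  · exact hφ.isSigned.inNormalForm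
  · unfold IsShort at hφ
    push Not at hφ
    obtain ⟨g, c, hφ⟩ := hφ
    rcases lt_or_ge (autSize (MulAut.conj g * φ * twist c)) (autSize φ) with h | h
    · have := ((ih _ h _ rfl).mul_twist_inv c).conj_mul g⁻¹
      simpa [mul_assoc] using this
    · have := ((ih _ (hφ h) _ rfl).mul_twist c).conj_mul g⁻¹
      simpa [mul_assoc] using this

theorem codeAut_reverse (r : List (Fin 2)) :
    codeAut r.reverse = twist 0 * twist 1 * (r.map twist).prod := by
  induction r using List.reverseRecOn with
  | nil => simp [codeAut]
  | append_singleton r c ih => simp [codeAut, ih, mul_assoc]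

theorem finite_isSigned : {d : MulAut F2 | IsSigned d}.Finite := by
  have hf : Function.Injective fun (d : {d : MulAut F2 | IsSigned d}) (c : Fin 2) =>
      (d.2 c).choose := by
    intro d d' h
    have key : ∀ c, d.1 (FreeGroup.of c) = d'.1 (FreeGroup.of c) := fun c => by
      rw [(d.2 c).choose_spec, (d'.2 c).choose_spec]
      exact congrArg (fun x => FreeGroup.mk [x]) (congrFun h c)
    exact Subtype.ext (mulAut_ext 0 (key _) (key _))
  exact Set.finite_coe_iff.1 (Finite.of_injective _ hf)

/-- Deciding whether an automorphic image of `u` lies in `H` reduces to finitely many instances of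
the corresponding question for the automorphisms `codeAut r`, up to conjugation. -/
theorem meetsAutOrbit_iff (u : F2) (H : Subgroup F2) :
    MeetsAutOrbit u H ↔ ∃ d ∈ {d : MulAut F2 | IsSigned d} ×ˢ {d : MulAut F2 | IsSigned d},
      ∃ r, ∃ g ∈ H.map (twist 0 * twist 1 * d.1).toMonoidHom, IsConj g (codeAut r (d.2 u)) := by
  constructor
  · rintro ⟨φ, hφ⟩
    obtain ⟨g, d₁, r, d₂, h₁, h₂, rfl⟩ := inNormalForm φ
    refine ⟨(d₁⁻¹, d₂), ⟨h₁.inv, h₂⟩, r.reverse, _, Subgroup.mem_map_of_mem _ hφ, ?_⟩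
    rw [codeAut_reverse]
    apply IsConj.symm
    refine isConj_iff.2 ⟨(twist 0 * twist 1 * d₁⁻¹) g, ?_⟩
    simp [MulAut.mul_apply]
  · rintro ⟨⟨d₁, d₂⟩, -, r, g, ⟨k, hk, rfl⟩, hg⟩
    obtain ⟨c, hc⟩ := isConj_iff.1 hg.symm
    refine ⟨(twist 0 * twist 1 * d₁)⁻¹ * (MulAut.conj c * codeAut r * d₂), ?_⟩
    rw [MulAut.mul_apply, MulAut.mul_apply, MulAut.mul_apply, MulAut.conj_apply, hc]
    simpa using hk

/-! ### Primitive recursion on words -/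

section Computability

variable {α β γ σ : Type*} [Primcodable α] [Primcodable β] [Primcodable γ] [Primcodable σ]

theorem PrimrecPred.forall_mem {f : α → List β} {p : α → β → Prop} (hf : Primrec f)
    (hp : PrimrecPred fun x : α × β => p x.1 x.2) : PrimrecPred fun a => ∀ b ∈ f a, p a b := by
  have h : PrimrecRel fun (b : β) (a : α) => p a b :=
    PrimrecPred.comp hp (Primrec.pair Primrec.snd Primrec.fst)
  exact PrimrecRel.comp h.forall_mem_list hf Primrec.id

theorem PrimrecPred.exists_mem {f : α → List β} {p : α → β → Prop} (hf : Primrec f)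
    (hp : PrimrecPred fun x : α × β => p x.1 x.2) : PrimrecPred fun a => ∃ b ∈ f a, p a b := by
  have h : PrimrecRel fun (b : β) (a : α) => p a b :=
    PrimrecPred.comp hp (Primrec.pair Primrec.snd Primrec.fst)
  exact PrimrecRel.comp h.exists_mem_list hf Primrec.id

theorem Primrec.list_mem {f : α → β} {g : α → List β} (hf : Primrec f) (hg : Primrec g) :
    PrimrecPred fun a => f a ∈ g a := by
  refine (PrimrecPred.exists_mem (p := fun a b => b = f a) hg
    (Primrec.eq.comp Primrec.snd (hf.comp Primrec.fst))).of_eq fun a => ?_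
  simp

/-- Unbounded search for a witness, along the encodings of the witnesses by numbers. -/
theorem REPred.exists_of_primrecPred {p : α → β → Prop}
    (hp : PrimrecPred fun x : α × β => p x.1 x.2) : REPred fun a => ∃ b, p a b := by
  classical
  let P : α → ℕ → Prop := fun a n => ∃ b ∈ (Encodable.decode (α := β) n).toList, p a b
  have hP : PrimrecPred fun x : α × ℕ => P x.1 x.2 :=
    PrimrecPred.exists_mem (p := fun (x : α × ℕ) b => p x.1 b)
      (Primrec.optionToList.comp (Primrec.decode.comp Primrec.snd))
      (hp.comp (Primrec.pair (Primrec.fst.comp Primrec.fst) Primrec.snd))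
  have h : Partrec fun a => Nat.rfind fun n => Part.some (decide (P a n)) :=
    Partrec.rfind (hP.computablePred.decide.partrec)
  refine h.dom_re.of_eq fun a => ?_
  refine Nat.rfind_dom.trans ⟨?_, ?_⟩
  · rintro ⟨n, hn, -⟩
    obtain ⟨b, -, hb⟩ := of_decide_eq_true (Part.mem_some_iff.1 hn).symm
    exact ⟨b, hb⟩
  · rintro ⟨b, hb⟩
    refine ⟨Encodable.encode b, ?_, fun _ => trivial⟩
    rw [Part.mem_some_iff]
    exact (decide_eq_true ⟨b, by simp, hb⟩).symm

theorem ComputablePred.comp {p : β → Prop} {f : α → β} (hp : ComputablePred p)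
    (hf : Computable f) : ComputablePred fun a => p (f a) := by
  obtain ⟨_, h⟩ := hp
  exact ⟨inferInstance, h.comp hf⟩

theorem ComputablePred.or {p q : α → Prop} (hp : ComputablePred p) (hq : ComputablePred q) :
    ComputablePred fun a => p a ∨ q a := by
  obtain ⟨_, hp⟩ := hp
  obtain ⟨_, hq⟩ := hq
  refine ⟨inferInstance, (Primrec.or.to_comp.comp hp hq).of_eq fun a => ?_⟩
  simp

theorem ComputablePred.exists_mem_finite {ι : Type*} {s : Set ι} (hs : s.Finite)
    {p : ι → α → Prop} (hp : ∀ i, ComputablePred (p i)) :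
    ComputablePred fun a => ∃ i ∈ s, p i a := by
  induction s, hs using Set.Finite.induction_on with
  | empty => exact (PrimrecPred.computablePred (Primrec.primrecPred
      (p := fun _ : α => False) (Primrec.const false))).of_eq fun a => by simp
  | @insert i _ _ _ ih => exact ((hp i).or ih).of_eq fun a => by simp

end Computability

theorem primrec_reduce : Primrec (FreeGroup.reduce : Word2 → Word2) := by
  let step : (Fin 2 × Bool) × Word2 → Word2 := fun x =>
    if x.2.head? = some (x.1.1, !x.1.2) then x.2.tail else x.1 :: x.2
  have hstep : Primrec step := by
    refine Primrec.ite (Primrec.eq.comp (Primrec.list_head?.comp Primrec.snd)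
      (Primrec.option_some.comp (?_ : Primrec fun x : (Fin 2 × Bool) × Word2 => (x.1.1, !x.1.2))))
      (Primrec.list_tail.comp Primrec.snd)
      (Primrec.list_cons.comp Primrec.fst Primrec.snd)
    exact (Primrec.dom_finite fun y : Fin 2 × Bool => (y.1, !y.2)).comp Primrec.fst
  refine (Primrec.list_foldr (f := fun w : Word2 => w) (g := fun _ => ([] : Word2))
    (h := fun _ x => step x) Primrec.id (Primrec.const []) (hstep.comp Primrec.snd)).of_eq
    fun w => ?_
  induction w with
  | nil => rfl
  | cons x w ih =>
    rw [List.foldr_cons, ih, FreeGroup.reduce.cons]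
    generalize FreeGroup.reduce w = l
    rcases l with _ | ⟨y, l⟩
    · simp [step]
    · obtain ⟨i, b⟩ := x
      obtain ⟨j, c⟩ := y
      by_cases h : i = j ∧ b = !c
      · obtain ⟨rfl, rfl⟩ := h; simp [step]
      · have : ¬ (j, c) = (i, !b) := by
          rintro h'; simp at h'; exact h (by simp [h'.1, h'.2])
        simp [step, h, this]

theorem primrec_invRev : Primrec (FreeGroup.invRev : Word2 → Word2) :=
  Primrec.list_reverse.comp (Primrec.list_map Primrec.id
    ((Primrec.dom_finite fun y : Fin 2 × Bool => (y.1, !y.2)).comp Primrec.snd))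

/-- The word obtained from `w` by replacing every letter by the word of its image under `φ`. -/
def substWord (φ : MulAut F2) (w : Word2) : Word2 :=
  w.flatMap fun x => (φ (FreeGroup.mk [x])).toWord

theorem mk_substWord (φ : MulAut F2) (w : Word2) :
    (FreeGroup.mk (substWord φ w) : F2) = φ (FreeGroup.mk w) := by
  induction w with
  | nil => exact (map_one φ).symm
  | cons x w ih =>
    rw [substWord, List.flatMap_cons, ← FreeGroup.mul_mk, ← substWord, ih, FreeGroup.mk_toWord,
      ← map_mul, FreeGroup.mul_mk, List.singleton_append]

theorem primrec_substWord (φ : MulAut F2) : Primrec (substWord φ) :=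
  Primrec.list_flatMap Primrec.id
    ((Primrec.dom_finite fun x : Fin 2 × Bool => (φ (FreeGroup.mk [x])).toWord).comp Primrec.snd)

theorem subgroupOfWords_map_substWord (φ : MulAut F2) (L : List Word2) :
    subgroupOfWords (L.map (substWord φ)) = (subgroupOfWords L).map φ.toMonoidHom := by
  unfold subgroupOfWords
  rw [MonoidHom.map_closure]
  congr 1
  ext g
  simp [Word2.toF2, mk_substWord]

/-- The reduced word of the image of `w` under `codeAut r`. -/
def codeWord (r : List (Fin 2)) (w : Word2) : Word2 :=
  FreeGroup.reduce (substWord (twist 0 * twist 1) (r.foldl (fun w c => substWord (twist c) w) w))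

theorem codeWord_eq (r : List (Fin 2)) (w : Word2) :
    codeWord r w = (codeAut r (FreeGroup.mk w)).toWord := by
  induction r generalizing w with
  | nil => rw [codeAut, ← mk_substWord, FreeGroup.toWord_mk, codeWord, List.foldl_nil]
  | cons c r ih =>
    rw [codeAut, MulAut.mul_apply, ← mk_substWord, ← ih, codeWord, codeWord, List.foldl_cons]

theorem primrec_substWord_twist :
    Primrec₂ fun (c : Fin 2) (w : Word2) => substWord (twist c) w := by
  let f : Fin 2 × Fin 2 × Bool → Word2 := fun y => (twist y.1 (FreeGroup.mk [y.2])).toWord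
  have hf : Primrec f := Primrec.dom_finite f
  have hf' : Primrec₂ fun (x : Fin 2 × Word2) (y : Fin 2 × Bool) => f (x.1, y) :=
    hf.comp (Primrec.pair (Primrec.fst.comp Primrec.fst) Primrec.snd)
  exact Primrec.list_flatMap Primrec.snd hf'

theorem primrec_codeWord : Primrec₂ codeWord := by
  have h : Primrec₂ fun (_ : List (Fin 2) × Word2) (y : Word2 × Fin 2) =>
      substWord (twist y.2) y.1 :=
    primrec_substWord_twist.comp (Primrec.snd.comp Primrec.snd) (Primrec.fst.comp Primrec.snd)
  have h' : Primrec fun x : List (Fin 2) × Word2 =>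
      x.1.foldl (fun w c => substWord (twist c) w) x.2 :=
    Primrec.list_foldl Primrec.fst Primrec.snd h
  exact primrec_reduce.comp ((primrec_substWord _).comp h')

/-- All words over the two letters whose length is at most `n`. -/
def wordsUpTo : ℕ → List (List (Fin 2))
  | 0 => [[]]
  | n + 1 => [] :: (wordsUpTo n).flatMap fun r => [0 :: r, 1 :: r]

theorem mem_wordsUpTo {n : ℕ} {r : List (Fin 2)} (h : r.length ≤ n) : r ∈ wordsUpTo n := by
  induction n generalizing r with
  | zero => simpa [wordsUpTo] using h
  | succ n ih =>
    rcases r with _ | ⟨c, r⟩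
    · simp [wordsUpTo]
    · have := ih (r := r) (by simpa using h)
      simp only [wordsUpTo, List.mem_cons, List.mem_flatMap]
      refine Or.inr ⟨r, this, ?_⟩
      fin_cases c <;> simp

theorem primrec_wordsUpTo : Primrec wordsUpTo := by
  have h : Primrec fun l : List (List (Fin 2)) => [] :: l.flatMap fun r => [0 :: r, 1 :: r] := by
    refine Primrec.list_cons.comp (Primrec.const []) (Primrec.list_flatMap Primrec.id ?_)
    have hc (i : Fin 2) : Primrec fun x : List (List (Fin 2)) × List (Fin 2) => i :: x.2 :=
      Primrec.list_cons.comp (Primrec.const i) Primrec.snd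
    exact Primrec.list_cons.comp (hc 0) (Primrec.list_cons.comp (hc 1) (Primrec.const []))
  refine (Primrec.nat_rec₁ [[]] (h.comp Primrec.snd).to₂).of_eq fun n => ?_
  induction n with
  | zero => rfl
  | succ n ih => simp only [wordsUpTo, ← ih]

theorem primrec_pow : Primrec₂ fun a b : ℕ => a ^ b :=
  Primrec₂.unpaired'.1 Nat.Primrec.pow

theorem primrec_tameBound : Primrec₂ tameBound := by
  -- the second argument of the recursion is iterated, together with the sum of its values
  have h : Primrec fun x : ℕ × ℕ => (2 ^ x.1 * x.1, x.2 + x.1) :=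
    Primrec.pair (Primrec.nat_mul.comp (primrec_pow.comp (Primrec.const 2) Primrec.fst) Primrec.fst)
      (Primrec.nat_add.comp Primrec.snd Primrec.fst)
  have key : ∀ t n s : ℕ, ((fun x : ℕ × ℕ => (2 ^ x.1 * x.1, x.2 + x.1))^[t] (n, s)).2 =
      s + tameBound t n := by
    intro t
    induction t with
    | zero => simp [tameBound]
    | succ t ih => intro n s; rw [Function.iterate_succ_apply, ih, tameBound]; ring
  refine (Primrec.snd.comp (Primrec.nat_iterate (α := ℕ × ℕ) Primrec.fst
    (Primrec.pair Primrec.snd (Primrec.const 0)) (h.comp Primrec.snd).to₂)).of_eq fun x => ?_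
  simp [key]

/-! ### Schreier graphs and finite obstructions -/

section Graphs

variable {V W α : Type*}

theorem Walk.map {E : V → α → V → Prop} {E' : W → α → W → Prop} (f : V → W)
    (hf : ∀ v i w, E v i w → E' (f v) i (f w)) {p : List (α × Bool)} {v w : V}
    (h : Walk E v p w) : Walk E' (f v) p (f w) := by
  induction p generalizing v with
  | nil => exact congrArg f h
  | cons x p ih =>
    obtain ⟨z, hz, h⟩ := h
    refine ⟨f z, ?_, ih h⟩
    obtain ⟨i, b⟩ := x
    cases b <;> simp only [EdgeStep] at hz ⊢ <;> simpa using hf _ _ _ (by simpa using hz)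

/-- An element labels a closed walk, up to conjugacy, if and only if the reduced form of some
rotation of its word does: if the word is `c k c⁻¹` with `k` cyclically reduced, rotation by the
length of `c` yields `k`. -/
theorem hasLoop_mk_iff [DecidableEq α] {E : V → α → V → Prop} (hE : Folded E)
    (g : FreeGroup α) : HasLoop E g ↔ ∃ i < g.toWord.length + 1, ∃ v,
      Walk E v (FreeGroup.reduce (g.toWord.drop i ++ g.toWord.take i)) v := by
  constructor
  · intro h
    have hc := FreeGroup.reduceCyclically.conj_conjugator_reduceCyclically g.toWord
    set c := FreeGroup.reduceCyclically.conjugator g.toWord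
    set k := FreeGroup.reduceCyclically g.toWord with hkdef
    have hk : FreeGroup.IsCyclicallyReduced k :=
      FreeGroup.reduceCyclically.isCyclicallyReduced FreeGroup.isReduced_toWord
    have hgk : IsConj g (FreeGroup.mk k) := by
      refine IsConj.symm (isConj_iff.2 ⟨FreeGroup.mk c, ?_⟩)
      rw [FreeGroup.inv_mk, FreeGroup.mul_mk, FreeGroup.mul_mk, hc, FreeGroup.mk_toWord]
    obtain ⟨v, hv⟩ := exists_walk_of_hasLoop_mk hE hk (h.conj hgk)
    have hl := congrArg List.length hc
    simp only [List.length_append] at hl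
    refine ⟨c.length, by omega, v, ?_⟩
    have hred : FreeGroup.reduce (g.toWord.drop c.length ++ g.toWord.take c.length) = k := by
      rw [← hc, List.append_assoc, List.drop_left, List.take_left, ← FreeGroup.toWord_mk]
      have : (FreeGroup.mk (k ++ FreeGroup.invRev c ++ c) : FreeGroup α) = FreeGroup.mk k := by
        rw [← FreeGroup.mul_mk, ← FreeGroup.mul_mk, ← FreeGroup.inv_mk]; group
      rw [this, FreeGroup.toWord_mk]
      exact hk.isReduced.reduce_eq
    rwa [hred]
  · rintro ⟨i, -, v, hv⟩
    refine ⟨v, _, ?_, hv⟩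
    rw [FreeGroup.reduce.self, ← FreeGroup.mul_mk]
    refine (isConj_mul_comm _ _).trans ?_
    rw [FreeGroup.mul_mk, List.take_append_drop, FreeGroup.mk_toWord]

/-- The graph on the natural numbers with a given list of labelled edges. -/
def listGraph (E : List (ℕ × Fin 2 × ℕ)) (v : ℕ) (i : Fin 2) (w : ℕ) : Prop := (v, i, w) ∈ E

/-- The endpoint of the step along the edge `e` from `v`, if `e` allows one labelled `x`. -/
def edgeEnd (x : Fin 2 × Bool) (v : ℕ) (e : ℕ × Fin 2 × ℕ) : Option ℕ :=
  if e.2.1 = x.1 ∧ x.2 = true ∧ e.1 = v then some e.2.2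
  else if e.2.1 = x.1 ∧ x.2 = false ∧ e.2.2 = v then some e.1 else none

/-- The endpoints of the walks from members of a list that are labelled by a given word. -/
def reach (E : List (ℕ × Fin 2 × ℕ)) (L : List ℕ) (p : Word2) : List ℕ :=
  p.foldl (fun L x => L.flatMap fun v => E.filterMap (edgeEnd x v)) L

theorem exists_edgeEnd_iff {E : List (ℕ × Fin 2 × ℕ)} {x : Fin 2 × Bool} {v w : ℕ} :
    (∃ e ∈ E, edgeEnd x v e = some w) ↔ EdgeStep (listGraph E) v x w := by
  obtain ⟨i, b⟩ := x
  cases b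
  · simp only [EdgeStep, listGraph, edgeEnd]
    constructor
    · rintro ⟨⟨s, j, t⟩, he, h⟩
      simp at h
      obtain ⟨⟨rfl, rfl⟩, rfl⟩ := h
      simpa using he
    · intro h
      exact ⟨_, by simpa using h, by simp⟩
  · simp only [EdgeStep, listGraph, edgeEnd]
    constructor
    · rintro ⟨⟨s, j, t⟩, he, h⟩
      simp at h
      obtain ⟨⟨rfl, rfl⟩, rfl⟩ := h
      simpa using he
    · intro h
      exact ⟨_, by simpa using h, by simp⟩

theorem mem_reach {E : List (ℕ × Fin 2 × ℕ)} {L : List ℕ} {p : Word2} {w : ℕ} :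
    w ∈ reach E L p ↔ ∃ v ∈ L, Walk (listGraph E) v p w := by
  induction p generalizing L with
  | nil => simp [reach, Walk]
  | cons x p ih =>
    rw [reach, List.foldl_cons, ← reach, ih]
    simp only [List.mem_flatMap, List.mem_filterMap, exists_edgeEnd_iff, Walk]
    exact ⟨fun ⟨z, ⟨v, hv, hz⟩, h⟩ => ⟨v, hv, z, hz, h⟩,
      fun ⟨v, hv, z, hz, h⟩ => ⟨z, ⟨v, hv, hz⟩, h⟩⟩

theorem primrec_edgeEnd :
    Primrec fun x : (Fin 2 × Bool) × ℕ × ℕ × Fin 2 × ℕ => edgeEnd x.1 x.2.1 x.2.2 := by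
  have he : Primrec fun x : (Fin 2 × Bool) × ℕ × ℕ × Fin 2 × ℕ => x.2.2 :=
    Primrec.snd.comp Primrec.snd
  have hv : Primrec fun x : (Fin 2 × Bool) × ℕ × ℕ × Fin 2 × ℕ => x.2.1 :=
    Primrec.fst.comp Primrec.snd
  have hs := Primrec.fst.comp he
  have ht := Primrec.snd.comp (Primrec.snd.comp he)
  have hi := Primrec.fst.comp (Primrec.snd.comp he)
  have hx1 : Primrec fun x : (Fin 2 × Bool) × ℕ × ℕ × Fin 2 × ℕ => x.1.1 :=
    Primrec.fst.comp Primrec.fst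
  have hx2 : Primrec fun x : (Fin 2 × Bool) × ℕ × ℕ × Fin 2 × ℕ => x.1.2 :=
    Primrec.snd.comp Primrec.fst
  have hlab := Primrec.eq.comp hi hx1
  exact Primrec.ite
    (hlab.and ((Primrec.eq.comp hx2 (Primrec.const true)).and (Primrec.eq.comp hs hv)))
    (Primrec.option_some.comp ht) (Primrec.ite
    (hlab.and ((Primrec.eq.comp hx2 (Primrec.const false)).and (Primrec.eq.comp ht hv)))
    (Primrec.option_some.comp hs) (Primrec.const none))

theorem primrec_reach :
    Primrec fun x : List (ℕ × Fin 2 × ℕ) × List ℕ × Word2 => reach x.1 x.2.1 x.2.2 := by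
  have h1 : Primrec₂ fun (y : (List (ℕ × Fin 2 × ℕ) × (Fin 2 × Bool)) × ℕ)
      (e : ℕ × Fin 2 × ℕ) => edgeEnd y.1.2 y.2 e :=
    primrec_edgeEnd.comp (Primrec.pair (Primrec.snd.comp (Primrec.fst.comp Primrec.fst))
      (Primrec.pair (Primrec.snd.comp Primrec.fst) Primrec.snd))
  have h2 : Primrec fun y : (List (ℕ × Fin 2 × ℕ) × (Fin 2 × Bool)) × ℕ =>
      y.1.1.filterMap (edgeEnd y.1.2 y.2) :=
    Primrec.listFilterMap (Primrec.fst.comp Primrec.fst) h1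
  have h3 : Primrec₂ fun (y : List (ℕ × Fin 2 × ℕ) × List ℕ × (Fin 2 × Bool)) (v : ℕ) =>
      y.1.filterMap (edgeEnd y.2.2 v) :=
    h2.comp (Primrec.pair (Primrec.pair (Primrec.fst.comp Primrec.fst)
      (Primrec.snd.comp (Primrec.snd.comp Primrec.fst))) Primrec.snd)
  have h4 : Primrec fun y : List (ℕ × Fin 2 × ℕ) × List ℕ × (Fin 2 × Bool) =>
      y.2.1.flatMap fun v => y.1.filterMap (edgeEnd y.2.2 v) :=
    Primrec.list_flatMap (Primrec.fst.comp Primrec.snd) h3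
  have h5 : Primrec₂ fun (x : List (ℕ × Fin 2 × ℕ) × List ℕ × Word2)
      (y : List ℕ × (Fin 2 × Bool)) => y.1.flatMap fun v => x.1.filterMap (edgeEnd y.2 v) :=
    h4.comp (Primrec.pair (Primrec.fst.comp Primrec.fst) Primrec.snd)
  exact Primrec.list_foldl (Primrec.snd.comp Primrec.snd) (Primrec.fst.comp Primrec.snd) h5

theorem primrecPred_walk {β : Type*} [Primcodable β] {E : β → List (ℕ × Fin 2 × ℕ)} {p : β → Word2}
    {v w : β → ℕ} (hE : Primrec E) (hp : Primrec p) (hv : Primrec v) (hw : Primrec w) :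
    PrimrecPred fun x => Walk (listGraph (E x)) (v x) (p x) (w x) := by
  refine (Primrec.list_mem hw (primrec_reach.comp (Primrec.pair hE (Primrec.pair
    (Primrec.list_cons.comp hv (Primrec.const [])) hp)))).of_eq fun x => ?_
  simp [mem_reach]

end Graphs

/-- Some `codeAut r` takes the element represented by `u` to a conjugate of an element of the
subgroup generated by `hs`. -/
def CodeAutMeets (u : Word2) (hs : List Word2) : Prop :=
  ∃ r, ∃ g ∈ subgroupOfWords hs, IsConj g (codeAut r u.toF2)

/-- A length up to which it suffices to search for `r` such that the image of `u` under `codeAut r`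
labels a loop in a graph with `n` vertices. -/
def searchLength (u : Word2) (n : ℕ) : ℕ :=
  tameBound u.length u.length + (2 ^ n ^ 2) ^ 6

/-- A folded graph on the numbers below `n` in which all words `hs` label loops at `v₀`, whereas the
image of `u` under `codeAut r` does not label a loop up to conjugation for any short `r`. -/
structure IsObstruction (u : Word2) (hs : List Word2) (n v₀ : ℕ)
    (E : List (ℕ × Fin 2 × ℕ)) : Prop where
  base : v₀ < n
  lt : ∀ e ∈ E, e.1 < n ∧ e.2.2 < n
  folded : ∀ e ∈ E, ∀ f ∈ E, e.2.1 = f.2.1 → (e.1 = f.1 ↔ e.2.2 = f.2.2)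
  walk : ∀ h ∈ hs, Walk (listGraph E) v₀ h v₀
  short : ∀ r ∈ wordsUpTo (searchLength u n),
    ∀ i ∈ List.range ((codeWord r u).length + 1), ∀ v ∈ List.range n,
      ¬ Walk (listGraph E) v
        (FreeGroup.reduce ((codeWord r u).drop i ++ (codeWord r u).take i)) v

theorem folded_listGraph_iff {E : List (ℕ × Fin 2 × ℕ)} : Folded (listGraph E) ↔
    ∀ e ∈ E, ∀ f ∈ E, e.2.1 = f.2.1 → (e.1 = f.1 ↔ e.2.2 = f.2.2) := by
  constructor
  · rintro ⟨h1, h2⟩ ⟨v, i, w⟩ he ⟨v', j, w'⟩ hf (rfl : i = j)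
    exact ⟨fun (h : v = v') => h1 v i w w' he (by rw [h]; exact hf),
      fun (h : w = w') => h2 v v' i w he (by rw [h]; exact hf)⟩
  · intro h
    exact ⟨fun v i w w' h1 h2 => (h _ h1 _ h2 rfl).1 rfl,
      fun v v' i w h1 h2 => (h _ h1 _ h2 rfl).2 rfl⟩

/-- An obstruction, although it involves finitely many automorphisms only, rules out all of them:
in a finite folded graph, closed walks already occur for short `r` if they occur at all. -/
theorem IsObstruction.not_codeAutMeets {u : Word2} {hs : List Word2} {n v₀ : ℕ}
    {E : List (ℕ × Fin 2 × ℕ)} (hE : IsObstruction u hs n v₀ E) : ¬ CodeAutMeets u hs := by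
  rintro ⟨r, g, hg, hr⟩
  let E' : Fin n → Fin 2 → Fin n → Prop := fun v i w => listGraph E v i w
  have hfold := folded_listGraph_iff.2 hE.folded
  have hE' : Folded E' :=
    ⟨fun v i w w' h h' => Fin.ext (hfold.1 _ _ _ _ h h'),
      fun v v' i w h h' => Fin.ext (hfold.2 _ _ _ _ h h')⟩
  let f : ℕ → Fin n := fun v => if h : v < n then ⟨v, h⟩ else ⟨v₀, hE.base⟩
  have hf : ∀ v i w, listGraph E v i w → E' (f v) i (f w) := by
    intro v i w h
    have := hE.lt _ h
    simp only [E', f, dif_pos this.1, dif_pos this.2]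
    exact h
  have hloop : HasLoop E' g := by
    refine ⟨f v₀, g.toWord, by rw [FreeGroup.mk_toWord], walk_toWord_of_mem_closure hE' ?_ hg⟩
    rintro _ ⟨w, hw, rfl⟩
    rw [Word2.toF2, FreeGroup.toWord_mk]
    exact ((hE.walk w hw).map f hf).reduce hE'
  obtain ⟨r', hr', h⟩ := (tameWithin_mk u).exists_short hE' (hloop.conj hr)
  obtain ⟨i, hi, v, hv⟩ := (hasLoop_mk_iff hE' _).1 h
  rw [Nat.card_fin] at hr'
  rw [← codeWord_eq] at hi hv
  exact hE.short r' (mem_wordsUpTo hr') i (List.mem_range.2 hi) v (List.mem_range.2 v.2)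
    (hv.map Fin.val fun _ _ _ h => h)

/-- The label of a walk in a Schreier graph moves its end to its start. The edges are oriented such
that a walk reads a word of the group element from left to right. -/
theorem Walk.eq_smul {α X : Type*} [MulAction (FreeGroup α) X] {v w : X} {p : List (α × Bool)}
    (h : Walk (fun (v : X) (i : α) w => v = FreeGroup.of i • w) v p w) :
    v = FreeGroup.mk p • w := by
  induction p generalizing v with
  | nil => exact h.trans (one_smul _ w).symm
  | cons x p ih =>
    obtain ⟨z, hz, h⟩ := h
    rw [← List.singleton_append, ← FreeGroup.mul_mk, mul_smul, ← ih h]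
    obtain ⟨i, b⟩ := x
    cases b
    · have hz : z = FreeGroup.of i • v := by simpa [EdgeStep] using hz
      rw [hz, show (FreeGroup.mk [(i, false)] : FreeGroup α) = (FreeGroup.of i)⁻¹ from rfl,
        inv_smul_smul]
    · have hz : v = FreeGroup.of i • z := by simpa [EdgeStep] using hz
      exact hz

/-- The part of the Schreier graph of the subgroup that is traced out by the words `hs` is an
obstruction. -/
theorem exists_isObstruction {u : Word2} {hs : List Word2} (h : ¬ CodeAutMeets u hs) :
    ∃ n v₀ E, IsObstruction u hs n v₀ E := by
  classical
  set H := subgroupOfWords hs with hH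
  let base : F2 ⧸ H := QuotientGroup.mk 1
  let L : List (F2 ⧸ H) := base :: hs.flatMap fun h => h.tails.map fun p => FreeGroup.mk p • base
  let T : Set (F2 ⧸ H) := {x | x ∈ L}
  have hT : T.Finite := List.finite_toSet L
  have : Finite T := hT
  -- the vertices are the cosets of the suffixes of the words `hs`
  let e : T ≃ Fin (Nat.card T) := Finite.equivFin T
  let n := Nat.card T
  let S : Set (ℕ × Fin 2 × ℕ) := {t | ∃ v w : T, (e v : ℕ) = t.1 ∧ (e w : ℕ) = t.2.2 ∧
    v.1 = FreeGroup.of t.2.1 • w.1}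
  have hS : S.Finite := by
    refine (Set.finite_range fun p : T × Fin 2 × T => ((e p.1 : ℕ), p.2.1, (e p.2.2 : ℕ))).subset ?_
    rintro ⟨a, i, b⟩ ⟨v, w, rfl, rfl, -⟩
    exact ⟨(v, i, w), rfl⟩
  have hmem : ∀ v i w, listGraph hS.toFinset.toList v i w ↔ (v, i, w) ∈ S := fun v i w => by
    rw [listGraph, Finset.mem_toList, Set.Finite.mem_toFinset]
  have hfold : Folded (listGraph hS.toFinset.toList) := by
    constructor
    · intro v i w w' h1 h2
      rw [hmem] at h1 h2
      obtain ⟨x, y, rfl, rfl, hxy⟩ := h1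
      obtain ⟨x', y', hx, rfl, hxy'⟩ := h2
      obtain rfl : x' = x := e.injective (Fin.ext hx)
      rw [hxy] at hxy'
      rw [Subtype.ext (smul_left_cancel _ hxy')]
    · intro v v' i w h1 h2
      rw [hmem] at h1 h2
      obtain ⟨x, y, rfl, rfl, hxy⟩ := h1
      obtain ⟨x', y', rfl, hy, hxy'⟩ := h2
      obtain rfl : y' = y := e.injective (Fin.ext hy)
      rw [Subtype.ext (hxy.trans hxy'.symm)]
  have hbase : base ∈ T := List.mem_cons_self
  refine ⟨n, e ⟨base, hbase⟩, hS.toFinset.toList, (e _).2, ?_, folded_listGraph_iff.1 hfold, ?_, ?_⟩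
  · rintro ⟨v, i, w⟩ ht
    obtain ⟨x, y, hx, hy, -⟩ := (hmem v i w).1 ht
    exact ⟨hx ▸ (e x).2, hy ▸ (e y).2⟩
  · intro k hk
    -- every suffix of `k` can be read along a walk that ends at the base vertex
    have key : ∀ p : Word2, (hp : p <:+ k) → ∃ hpT : FreeGroup.mk p • base ∈ T,
        Walk (listGraph hS.toFinset.toList) (e ⟨_, hpT⟩) p (e ⟨base, hbase⟩) := by
      intro p hp
      induction p with
      | nil =>
        have h1 : (FreeGroup.mk [] : F2) • base = base := one_smul _ base
        exact ⟨h1 ▸ hbase, by simp only [h1]; rfl⟩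
      | cons x p ih =>
        obtain ⟨hz, hwalk⟩ := ih ((List.suffix_cons x p).trans hp)
        have hpT : FreeGroup.mk (x :: p) • base ∈ T := by
          refine List.mem_cons_of_mem _ (List.mem_flatMap.2 ⟨k, hk, List.mem_map.2 ⟨_, ?_, rfl⟩⟩)
          exact (List.mem_tails _ _).2 hp
        refine ⟨hpT, _, ?_, hwalk⟩
        obtain ⟨i, b⟩ := x
        cases b
        · simp only [EdgeStep, hmem]
          refine ⟨_, _, rfl, rfl, ?_⟩
          change FreeGroup.mk p • base = FreeGroup.of i • FreeGroup.mk ((i, false) :: p) • base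
          rw [smul_smul, of_eq_mk, FreeGroup.mul_mk]
          congr 1
          rw [show [(i, true)] ++ (i, false) :: p = [(i, true)] ++ [(i, false)] ++ p from rfl,
            ← FreeGroup.mul_mk, ← FreeGroup.mul_mk, mk_false, ← of_eq_mk, mul_inv_cancel, one_mul]
        · simp only [EdgeStep, hmem]
          refine ⟨_, _, rfl, rfl, ?_⟩
          change FreeGroup.mk ((i, true) :: p) • base = FreeGroup.of i • FreeGroup.mk p • base
          rw [smul_smul, of_eq_mk, FreeGroup.mul_mk]
          rfl
    obtain ⟨hkT, hw⟩ := key k (List.suffix_refl k)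
    have hk1 : FreeGroup.mk k • base = base := by
      have : (FreeGroup.mk k : F2) ∈ H := Subgroup.subset_closure ⟨k, hk, rfl⟩
      refine QuotientGroup.eq.2 ?_
      simpa only [smul_eq_mul, mul_one] using H.inv_mem this
    simpa only [hk1] using hw
  · intro r _ i hi v _ hw
    -- a closed walk lifts to the Schreier graph of `H`, where its label is conjugate into `H`
    apply h
    rw [codeWord_eq] at hi hw
    obtain ⟨v', p, hp, hw⟩ := (hasLoop_mk_iff hfold _).2 ⟨i, List.mem_range.1 hi, v, hw⟩
    let f : ℕ → F2 ⧸ H := fun v => if h : v < Nat.card T then (e.symm ⟨v, h⟩).1 else base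
    have hf : ∀ v i w, listGraph hS.toFinset.toList v i w → f v = FreeGroup.of i • f w := by
      intro v i w h
      obtain ⟨x, y, rfl, rfl, hxy⟩ := (hmem v i w).1 h
      have hfe : ∀ x : T, f (e x) = x.1 := fun x => by
        simp only [f, dif_pos (e x).2, Fin.eta, Equiv.symm_apply_apply]
      rw [hfe, hfe, hxy]
    have := (hw.map f hf).eq_smul
    obtain ⟨x, hx⟩ := QuotientGroup.mk_surjective (f v')
    rw [← hx] at this
    refine ⟨r, x⁻¹ * (FreeGroup.mk p * x), QuotientGroup.eq.1 this, ?_⟩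
    refine IsConj.trans (isConj_iff.2 ⟨x, by group⟩) hp

/-! ### The decision procedure -/

theorem primrecPred_folded {β : Type*} [Primcodable β] {E : β → List (ℕ × Fin 2 × ℕ)}
    (hE : Primrec E) : PrimrecPred fun x => ∀ e ∈ E x, ∀ f ∈ E x,
      e.2.1 = f.2.1 → (e.1 = f.1 ↔ e.2.2 = f.2.2) := by
  have he : Primrec fun y : (β × ℕ × Fin 2 × ℕ) × ℕ × Fin 2 × ℕ => y.1.2 :=
    Primrec.snd.comp Primrec.fst
  have hf : Primrec fun y : (β × ℕ × Fin 2 × ℕ) × ℕ × Fin 2 × ℕ => y.2 := Primrec.snd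
  have ha : PrimrecPred fun y : (β × ℕ × Fin 2 × ℕ) × ℕ × Fin 2 × ℕ => y.1.2.2.1 = y.2.2.1 :=
    Primrec.eq.comp (Primrec.fst.comp (Primrec.snd.comp he))
      (Primrec.fst.comp (Primrec.snd.comp hf))
  have hb : PrimrecPred fun y : (β × ℕ × Fin 2 × ℕ) × ℕ × Fin 2 × ℕ => y.1.2.1 = y.2.1 :=
    Primrec.eq.comp (Primrec.fst.comp he) (Primrec.fst.comp hf)
  have hc : PrimrecPred fun y : (β × ℕ × Fin 2 × ℕ) × ℕ × Fin 2 × ℕ => y.1.2.2.2 = y.2.2.2 :=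
    Primrec.eq.comp (Primrec.snd.comp (Primrec.snd.comp he))
      (Primrec.snd.comp (Primrec.snd.comp hf))
  have h : PrimrecPred fun y : (β × ℕ × Fin 2 × ℕ) × ℕ × Fin 2 × ℕ =>
      y.1.2.2.1 = y.2.2.1 → (y.1.2.1 = y.2.1 ↔ y.1.2.2.2 = y.2.2.2) :=
    (ha.not.or ((hb.and hc).or (hb.not.and hc.not))).of_eq fun y => by tauto
  have h' : PrimrecPred fun y : β × ℕ × Fin 2 × ℕ => ∀ f ∈ E y.1,
      y.2.2.1 = f.2.1 → (y.2.1 = f.1 ↔ y.2.2.2 = f.2.2) :=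
    PrimrecPred.forall_mem (hE.comp Primrec.fst) h
  exact PrimrecPred.forall_mem hE h'

theorem primrec_searchLength {β : Type*} [Primcodable β] {u : β → Word2} {n : β → ℕ}
    (hu : Primrec u) (hn : Primrec n) : Primrec fun x => searchLength (u x) (n x) := by
  have hlen := Primrec.list_length.comp hu
  have h1 : Primrec fun x => 2 ^ n x ^ 2 :=
    primrec_pow.comp (Primrec.const 2) (primrec_pow.comp hn (Primrec.const 2))
  have h2 : Primrec fun x => (2 ^ n x ^ 2) ^ 6 := primrec_pow.comp h1 (Primrec.const 6)
  exact Primrec.nat_add.comp (primrec_tameBound.comp hlen hlen) h2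

theorem primrecPred_short {β : Type*} [Primcodable β] {u : β → Word2} {n : β → ℕ}
    {E : β → List (ℕ × Fin 2 × ℕ)} (hu : Primrec u) (hn : Primrec n) (hE : Primrec E) :
    PrimrecPred fun x => ∀ r ∈ wordsUpTo (searchLength (u x) (n x)),
      ∀ i ∈ List.range ((codeWord r (u x)).length + 1), ∀ v ∈ List.range (n x),
        ¬ Walk (listGraph (E x)) v
          (FreeGroup.reduce ((codeWord r (u x)).drop i ++ (codeWord r (u x)).take i)) v := by
  have hcode : Primrec fun y : β × List (Fin 2) => codeWord y.2 (u y.1) :=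
    primrec_codeWord.comp Primrec.snd (hu.comp Primrec.fst)
  have hi : Primrec fun z : ((β × List (Fin 2)) × ℕ) × ℕ => z.1.2 := Primrec.snd.comp Primrec.fst
  have hw : Primrec fun z : ((β × List (Fin 2)) × ℕ) × ℕ => codeWord z.1.1.2 (u z.1.1.1) :=
    hcode.comp (Primrec.fst.comp Primrec.fst)
  have hred : Primrec fun z : ((β × List (Fin 2)) × ℕ) × ℕ => FreeGroup.reduce
      ((codeWord z.1.1.2 (u z.1.1.1)).drop z.1.2 ++ (codeWord z.1.1.2 (u z.1.1.1)).take z.1.2) :=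
    primrec_reduce.comp
      (Primrec.list_append.comp (Primrec.list_drop.comp hi hw) (Primrec.list_take.comp hi hw))
  have h1 := PrimrecPred.not (primrecPred_walk
    (hE.comp (Primrec.fst.comp (Primrec.fst.comp Primrec.fst))) hred Primrec.snd Primrec.snd)
  have h2 : PrimrecPred fun z : (β × List (Fin 2)) × ℕ => ∀ v ∈ List.range (n z.1.1),
      ¬ Walk (listGraph (E z.1.1)) v (FreeGroup.reduce
        ((codeWord z.1.2 (u z.1.1)).drop z.2 ++ (codeWord z.1.2 (u z.1.1)).take z.2)) v :=
    PrimrecPred.forall_mem (Primrec.list_range.comp (hn.comp (Primrec.fst.comp Primrec.fst))) h1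
  have h3 : PrimrecPred fun y : β × List (Fin 2) =>
      ∀ i ∈ List.range ((codeWord y.2 (u y.1)).length + 1), ∀ v ∈ List.range (n y.1),
      ¬ Walk (listGraph (E y.1)) v (FreeGroup.reduce
        ((codeWord y.2 (u y.1)).drop i ++ (codeWord y.2 (u y.1)).take i)) v :=
    PrimrecPred.forall_mem
      (Primrec.list_range.comp (Primrec.succ.comp (Primrec.list_length.comp hcode))) h2
  exact PrimrecPred.forall_mem (primrec_wordsUpTo.comp (primrec_searchLength hu hn)) h3

theorem primrecPred_isObstruction : PrimrecPred
    fun x : (Word2 × List Word2) × ℕ × ℕ × List (ℕ × Fin 2 × ℕ) =>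
      IsObstruction x.1.1 x.1.2 x.2.1 x.2.2.1 x.2.2.2 := by
  let A := (Word2 × List Word2) × ℕ × ℕ × List (ℕ × Fin 2 × ℕ)
  have hu : Primrec fun x : A => x.1.1 := Primrec.fst.comp Primrec.fst
  have hh : Primrec fun x : A => x.1.2 := Primrec.snd.comp Primrec.fst
  have hn : Primrec fun x : A => x.2.1 := Primrec.fst.comp Primrec.snd
  have hv : Primrec fun x : A => x.2.2.1 := Primrec.fst.comp (Primrec.snd.comp Primrec.snd)
  have hE : Primrec fun x : A => x.2.2.2 := Primrec.snd.comp (Primrec.snd.comp Primrec.snd)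
  have h1 : PrimrecPred fun x : A => x.2.2.1 < x.2.1 := Primrec.nat_lt.comp hv hn
  have h2 : PrimrecPred fun x : A => ∀ e ∈ x.2.2.2, e.1 < x.2.1 ∧ e.2.2 < x.2.1 := by
    refine PrimrecPred.forall_mem hE (PrimrecPred.and ?_ ?_)
    · exact Primrec.nat_lt.comp (Primrec.fst.comp Primrec.snd) (hn.comp Primrec.fst)
    · exact Primrec.nat_lt.comp (Primrec.snd.comp (Primrec.snd.comp Primrec.snd))
        (hn.comp Primrec.fst)
  have h3 := primrecPred_folded hE
  have h4 : PrimrecPred fun x : A => ∀ h ∈ x.1.2, Walk (listGraph x.2.2.2) x.2.2.1 h x.2.2.1 :=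
    PrimrecPred.forall_mem hh (primrecPred_walk (hE.comp Primrec.fst) Primrec.snd
      (hv.comp Primrec.fst) (hv.comp Primrec.fst))
  have h5 := primrecPred_short hu hn hE
  refine (h1.and (h2.and (h3.and (h4.and h5)))).of_eq fun x => ?_
  exact ⟨fun ⟨h1, h2, h3, h4, h5⟩ => ⟨h1, h2, h3, h4, h5⟩,
    fun ⟨h1, h2, h3, h4, h5⟩ => ⟨h1, h2, h3, h4, h5⟩⟩

theorem rePred_not_codeAutMeets :
    REPred fun p : Word2 × List Word2 => ¬ CodeAutMeets p.1 p.2 := by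
  refine (REPred.exists_of_primrecPred (p := fun (p : Word2 × List Word2)
    (c : ℕ × ℕ × List (ℕ × Fin 2 × ℕ)) => IsObstruction p.1 p.2 c.1 c.2.1 c.2.2)
    primrecPred_isObstruction).of_eq fun p => ⟨?_, ?_⟩
  · rintro ⟨c, hc⟩
    exact hc.not_codeAutMeets
  · intro h
    obtain ⟨n, v, E, hE⟩ := exists_isObstruction h
    exact ⟨(n, v, E), hE⟩

theorem invRev_flatten (k : List Word2) :
    FreeGroup.invRev k.flatten = (k.map FreeGroup.invRev).reverse.flatten := by
  induction k with
  | nil => rfl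
  | cons w k ih => simp [← ih, FreeGroup.invRev, -List.map_flatten]

theorem mem_subgroupOfWords_iff {g : F2} {hs : List Word2} : g ∈ subgroupOfWords hs ↔
    ∃ k : List Word2, (∀ w ∈ k, w ∈ hs ∨ FreeGroup.invRev w ∈ hs) ∧ FreeGroup.mk k.flatten = g := by
  constructor
  · intro hg
    induction hg using Subgroup.closure_induction with
    | mem x hx =>
      obtain ⟨w, hw, rfl⟩ := hx
      exact ⟨[w], by simp [hw], by simp [Word2.toF2]⟩
    | one => exact ⟨[], by simp, rfl⟩
    | mul x y _ _ hx hy =>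
      obtain ⟨k, hk, rfl⟩ := hx
      obtain ⟨l, hl, rfl⟩ := hy
      refine ⟨k ++ l, fun w hw => ?_, by rw [List.flatten_append, FreeGroup.mul_mk]⟩
      rcases List.mem_append.1 hw with hw | hw
      · exact hk w hw
      · exact hl w hw
    | inv x _ hx =>
      obtain ⟨k, hk, rfl⟩ := hx
      refine ⟨(k.map FreeGroup.invRev).reverse, ?_, ?_⟩
      · simp only [List.mem_reverse, List.mem_map]
        rintro _ ⟨w, hw, rfl⟩
        rw [FreeGroup.invRev_invRev]
        exact (hk w hw).symm
      · rw [FreeGroup.inv_mk]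
        exact congrArg FreeGroup.mk (invRev_flatten k).symm
  · rintro ⟨k, hk, rfl⟩
    induction k with
    | nil => exact one_mem _
    | cons w k ih =>
      rw [List.flatten_cons, ← FreeGroup.mul_mk]
      refine mul_mem ?_ (ih fun w hw => hk w (List.mem_cons_of_mem _ hw))
      rcases hk w List.mem_cons_self with h | h
      · exact Subgroup.subset_closure ⟨w, h, rfl⟩
      · have : (FreeGroup.mk (FreeGroup.invRev w) : F2) ∈ subgroupOfWords hs :=
          Subgroup.subset_closure ⟨_, h, rfl⟩
        rwa [← FreeGroup.inv_mk, inv_mem_iff] at this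

theorem rePred_codeAutMeets : REPred fun p : Word2 × List Word2 => CodeAutMeets p.1 p.2 := by
  let A := (Word2 × List Word2) × List (Fin 2) × Word2 × List Word2
  -- a witness consists of the list of twists, a conjugating word and a product of generators
  have h1 : PrimrecPred fun x : A =>
      ∀ w ∈ x.2.2.2, w ∈ x.1.2 ∨ FreeGroup.invRev w ∈ x.1.2 := by
    have hs : Primrec fun y : A × Word2 => y.1.1.2 :=
      Primrec.snd.comp (Primrec.fst.comp Primrec.fst)
    exact PrimrecPred.forall_mem (Primrec.snd.comp (Primrec.snd.comp Primrec.snd))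
      ((Primrec.list_mem Primrec.snd hs).or
        (Primrec.list_mem (primrec_invRev.comp Primrec.snd) hs))
  have h2 : PrimrecPred fun x : A => FreeGroup.reduce (x.2.2.1 ++ codeWord x.2.1 x.1.1 ++
      FreeGroup.invRev x.2.2.1) = FreeGroup.reduce x.2.2.2.flatten := by
    have hc : Primrec fun x : A => x.2.2.1 := Primrec.fst.comp (Primrec.snd.comp Primrec.snd)
    have hw : Primrec fun x : A => codeWord x.2.1 x.1.1 :=
      primrec_codeWord.comp (Primrec.fst.comp Primrec.snd) (Primrec.fst.comp Primrec.fst)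
    exact Primrec.eq.comp
      (primrec_reduce.comp (Primrec.list_append.comp (Primrec.list_append.comp hc hw)
        (primrec_invRev.comp hc)))
      (primrec_reduce.comp (Primrec.list_flatten.comp
        (Primrec.snd.comp (Primrec.snd.comp Primrec.snd))))
  have hval (r : List (Fin 2)) (u c : Word2) : (FreeGroup.mk (c ++ codeWord r u ++
      FreeGroup.invRev c) : F2) =
      FreeGroup.mk c * codeAut r u.toF2 * (FreeGroup.mk c)⁻¹ := by
    rw [← FreeGroup.mul_mk, ← FreeGroup.mul_mk, codeWord_eq, FreeGroup.mk_toWord,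
      ← FreeGroup.inv_mk, Word2.toF2]
  refine (REPred.exists_of_primrecPred (p := fun (p : Word2 × List Word2)
    (c : List (Fin 2) × Word2 × List Word2) =>
      (∀ w ∈ c.2.2, w ∈ p.2 ∨ FreeGroup.invRev w ∈ p.2) ∧ FreeGroup.reduce (c.2.1 ++
        codeWord c.1 p.1 ++ FreeGroup.invRev c.2.1) = FreeGroup.reduce c.2.2.flatten)
    (h1.and h2)).of_eq fun p => ⟨?_, ?_⟩
  · rintro ⟨⟨r, c, k⟩, hk, hr⟩
    refine ⟨r, _, mem_subgroupOfWords_iff.2 ⟨k, hk, rfl⟩, ?_⟩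
    rw [← FreeGroup.toWord_mk, ← FreeGroup.toWord_mk, FreeGroup.toWord_inj, hval] at hr
    exact (isConj_iff.2 ⟨_, hr⟩).symm
  · rintro ⟨r, g, hg, hr⟩
    obtain ⟨k, hk, rfl⟩ := mem_subgroupOfWords_iff.1 hg
    obtain ⟨c, hc⟩ := isConj_iff.1 hr.symm
    refine ⟨(r, c.toWord, k), hk, ?_⟩
    rw [← FreeGroup.toWord_mk, ← FreeGroup.toWord_mk, FreeGroup.toWord_inj, hval,
      FreeGroup.mk_toWord, hc]

theorem computablePred_codeAutMeets :
    ComputablePred fun p : Word2 × List Word2 => CodeAutMeets p.1 p.2 :=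
  ComputablePred.computable_iff_re_compl_re'.2 ⟨rePred_codeAutMeets, rePred_not_codeAutMeets⟩

theorem meetsAutOrbit_iff_codeAutMeets (u : Word2) (hs : List Word2) :
    MeetsAutOrbit u.toF2 (subgroupOfWords hs) ↔
      ∃ d ∈ {d : MulAut F2 | IsSigned d} ×ˢ {d : MulAut F2 | IsSigned d},
        CodeAutMeets (substWord d.2 u) (hs.map (substWord (twist 0 * twist 1 * d.1))) := by
  rw [meetsAutOrbit_iff]
  refine exists_congr fun d => and_congr_right fun _ => ?_
  rw [CodeAutMeets, subgroupOfWords_map_substWord, Word2.toF2, Word2.toF2, mk_substWord]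

theorem mainTheorem2 :
    ComputablePred (fun p : Word2 × List Word2 =>
      MeetsAutOrbit (Word2.toF2 p.1) (subgroupOfWords p.2)) := by
  have hred (d : MulAut F2 × MulAut F2) : Primrec fun p : Word2 × List Word2 =>
      (substWord d.2 p.1, p.2.map (substWord (twist 0 * twist 1 * d.1))) := by
    have h : Primrec₂ fun (_ : Word2 × List Word2) (w : Word2) =>
        substWord (twist 0 * twist 1 * d.1) w := (primrec_substWord _).comp Primrec.snd
    exact Primrec.pair ((primrec_substWord _).comp Primrec.fst) (Primrec.list_map Primrec.snd h)
  refine (ComputablePred.exists_mem_finite (finite_isSigned.prod finite_isSigned)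
    fun d => computablePred_codeAutMeets.comp (hred d).to_comp).of_eq fun p => ?_
  exact (meetsAutOrbit_iff_codeAutMeets p.1 p.2).symm
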